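/- Let $\mathscr{A}$ be a finitely complete bicategory, that is, a bicategory with a biterminal object, bipullbacks and cotensors with the ordinal $\mathbf{2}$. A span $(u,S,p):X\to Y$ in $\mathscr{A}$ is a diagram $X\xleftarrow{u}S\xrightarrow{p}Y$. Spans from $X$ to $Y$ form a bicategory $\mathrm{Spn}\mathscr{A}(X,Y)$: a morphism $(u,S,p)\to(u',S',p')$ is a morphism $h:S\to S'$ of $\mathscr{A}$ together with invertible 2-cells $u'h\cong u$ and $p'h\cong p$, and a 2-cell $h\Rightarrow k$ is a 2-cell of $\mathscr{A}$ compatible with these invertible 2-cells. These are the hom bicategories of the tricategory $\mathrm{Spn}\mathscr{A}$, in which spans are composed by bipullback and the identity of $X$ is $(1_X,X,1_X)$. For $f:X\to Y$ in $\mathscr{A}$ put $f_*=(1_X,X,f):X\to Y$. A morphism $f:X\to Y$ of a tricategory $\mathscr{T}$ has a right biadjoint if there are a morphism $g:Y\to X$, a unit $\eta:1_X\to gf$ and a counit $\varepsilon:fg\to 1_Y$ such that, modulo the associativity and unit constraints, the composites $f\to fgf\to f$ and $g\to gfg\to g$ are isomorphic (by invertible 3-cells) to identities. A pseudofunctor $P:\mathscr{E}\to\mathscr{B}$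 between bicategories is a groupoid fibration when (a) for every object $X$ of $\mathscr{E}$ and every $f:B\to PX$ in $\mathscr{B}$ there are $x:Z\to X$ in $\mathscr{E}$ and an equivalence $e:B\to PZ$ with $Px\circ e\cong f$; (b) for every morphism $x:Z\to X$ and every object $K$ of $\mathscr{E}$ the canonical functor from $\mathscr{E}(K,Z)$ to the pseudopullback of $\mathscr{B}(PK,Px):\mathscr{B}(PK,PZ)\to\mathscr{B}(PK,PX)$ and $P:\mathscr{E}(K,X)\to\mathscr{B}(PK,PX)$ is an equivalence of categories; (c) every 2-cell $\sigma:x'\Rightarrow x:Z\to X$ of $\mathscr{E}$ is a (strongly) cartesian morphism for the functor $P:\mathscr{E}(Z,X)\to\mathscr{B}(PZ,PX)$. A morphism $m:E\to B$ of a tricategory $\mathscr{T}$ is a groupoid fibration when for all objects $K$ the pseudofunctor $\mathscr{T}(K,m):\mathscr{T}(K,E)\to\mathscr{T}(K,B)$ is a groupoid fibration. Then for every span $(u,S,p)$ from $X$ to $Y$ in $\mathscr{A}$ the following conditions are equivalent: (i) the morphism $(u,S,p):X\to Y$ has a right biadjoint in the tricategory $\mathrm{Spn}\mathscr{A}$;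 (ii) the morphism $u:S\to X$ is an equivalence in $\mathscr{A}$; (iii) $(u,S,p)$ is equivalent in $\mathrm{Spn}\mathscr{A}(X,Y)$ to $f_*$ for some morphism $f:X\to Y$ of $\mathscr{A}$; (iv) the morphism $(u,S,p):X\to Y$ is a groupoid fibration in the tricategory $\mathrm{Spn}\mathscr{A}$. -/

import Mathlib

open CategoryTheory Bicategory

universe w v u w₁ v₁ u₁ w₂ v₂ u₂

noncomputable section

namespace BicatSpan

section Limits

variable {A : Type u} [Bicategory.{w, v} A]

/-- A 1-cell of a bicategory is an equivalence when it has an inverse up to invertible 2-cells. -/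
def IsEquiv {X Y : A} (f : X ⟶ Y) : Prop :=
  ∃ g : Y ⟶ X, Nonempty (f ≫ g ≅ 𝟙 X) ∧ Nonempty (g ≫ f ≅ 𝟙 Y)

/-- A square over the cospan `n : X ⟶ C`, `p : Y ⟶ C`, commuting up to an invertible 2-cell. -/
structure Square {X Y C : A} (n : X ⟶ C) (p : Y ⟶ C) where
  pt : A
  fst : pt ⟶ X
  snd : pt ⟶ Y
  iso : fst ≫ n ≅ snd ≫ p

/-- The whiskering of the 2-cell of a square by a 1-cell into its vertex. -/
def Square.cell {X Y C : A} {n : X ⟶ C} {p : Y ⟶ C} (s : Square n p) {K : A} (t : K ⟶ s.pt) :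
    (t ≫ s.fst) ≫ n ≅ (t ≫ s.snd) ≫ p :=
  α_ t s.fst n ≪≫ whiskerLeftIso t s.iso ≪≫ (α_ t s.snd p).symm

theorem Square.cell_hom {X Y C : A} {n : X ⟶ C} {p : Y ⟶ C} (s : Square n p) {K : A}
    (t : K ⟶ s.pt) :
    (s.cell t).hom = (α_ t s.fst n).hom ≫ t ◁ s.iso.hom ≫ (α_ t s.snd p).inv := rfl

theorem Square.cell_naturality {X Y C : A} {n : X ⟶ C} {p : Y ⟶ C} (s : Square n p) {K : A}
    {t t' : K ⟶ s.pt} (σ : t ⟶ t') :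
    σ ▷ s.fst ▷ n ≫ (s.cell t').hom = (s.cell t).hom ≫ σ ▷ s.snd ▷ p := by
  simp only [Square.cell_hom, Category.assoc, associator_naturality_left_assoc,
    ← whisker_exchange_assoc, associator_inv_naturality_left]

/-- The functor from `A(K, P)` to the pseudopullback of `A(K, n)` and `A(K, p)` induced by a square
with vertex `P`. -/
def Square.toPseudopullback {X Y C : A} {n : X ⟶ C} {p : Y ⟶ C} (s : Square n p) (K : A) :
    (K ⟶ s.pt) ⥤ Limits.CategoricalPullback (postcomp K n) (postcomp K p) where
  obj t := ⟨t ≫ s.fst, t ≫ s.snd, s.cell t⟩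
  map σ := ⟨σ ▷ s.fst, σ ▷ s.snd, s.cell_naturality σ⟩
  map_id _ := Limits.CategoricalPullback.hom_ext (id_whiskerRight _ _) (id_whiskerRight _ _)
  map_comp _ _ :=
    Limits.CategoricalPullback.hom_ext (comp_whiskerRight _ _ _) (comp_whiskerRight _ _ _)

/-- The square is a bipullback. -/
def Square.IsBipullback {X Y C : A} {n : X ⟶ C} {p : Y ⟶ C} (s : Square n p) : Prop :=
  ∀ K : A, (s.toPseudopullback K).IsEquivalence

/-- A biterminal object: every `A(K, T)` is equivalent to the terminal category. -/
def IsBiterminal (T : A) : Prop :=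
  ∀ K : A, (Functor.star.{0} (K ⟶ T)).IsEquivalence

/-- The functor `A(K, P) ⥤ A(K, X)^𝟚` induced by a 2-cell `lam` between 1-cells `P ⟶ X`. -/
@[simps]
def toArrow {P X : A} {d c : P ⟶ X} (lam : d ⟶ c) (K : A) : (K ⟶ P) ⥤ Arrow (K ⟶ X) where
  obj t := Arrow.mk (t ◁ lam)
  map σ := Arrow.homMk (σ ▷ d) (σ ▷ c) (by simp [whisker_exchange])

/-- The 2-cell `lam` exhibits `P` as the (bicategorical) cotensor of `X` with the ordinal `𝟚`. -/
def IsCotensorTwo {P X : A} {d c : P ⟶ X} (lam : d ⟶ c) : Prop :=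
  ∀ K : A, (toArrow lam K).IsEquivalence

variable (A) in
/-- A finitely complete bicategory: it has a biterminal object, bipullbacks, and cotensors with
the ordinal `𝟚` (and hence all finite bicategorical limits). -/
class FinitelyComplete : Prop where
  exists_biterminal : ∃ T : A, IsBiterminal T
  exists_bipullback : ∀ {X Y C : A} (n : X ⟶ C) (p : Y ⟶ C), ∃ s : Square n p, s.IsBipullback
  exists_cotensorTwo : ∀ X : A, ∃ (P : A) (d c : P ⟶ X) (lam : d ⟶ c), IsCotensorTwo lam

/-! A chosen bipullback of each cospan, and its universal property in elementary terms. -/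

variable [FinitelyComplete A] {X Y C : A} (n : X ⟶ C) (p : Y ⟶ C)

def bipb : Square n p := (FinitelyComplete.exists_bipullback n p).choose

theorem bipb_isBipullback : (bipb n p).IsBipullback :=
  (FinitelyComplete.exists_bipullback n p).choose_spec

instance (K : A) : ((bipb n p).toPseudopullback K).IsEquivalence := bipb_isBipullback n p K

variable {n p} {K : A}

/-- The 1-cell into the bipullback induced by a square. -/
def lift (a : K ⟶ X) (b : K ⟶ Y) (φ : a ≫ n ≅ b ≫ p) : K ⟶ (bipb n p).pt :=
  ((bipb n p).toPseudopullback K).objPreimage ⟨a, b, φ⟩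

def liftIso (a : K ⟶ X) (b : K ⟶ Y) (φ : a ≫ n ≅ b ≫ p) :
    ((bipb n p).toPseudopullback K).obj (lift a b φ) ≅ ⟨a, b, φ⟩ :=
  ((bipb n p).toPseudopullback K).objObjPreimageIso ⟨a, b, φ⟩

def liftFst (a : K ⟶ X) (b : K ⟶ Y) (φ : a ≫ n ≅ b ≫ p) : lift a b φ ≫ (bipb n p).fst ≅ a :=
  (Limits.CategoricalPullback.π₁ _ _).mapIso (liftIso a b φ)

def liftSnd (a : K ⟶ X) (b : K ⟶ Y) (φ : a ≫ n ≅ b ≫ p) : lift a b φ ≫ (bipb n p).snd ≅ b :=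
  (Limits.CategoricalPullback.π₂ _ _).mapIso (liftIso a b φ)

theorem liftFst_cell (a : K ⟶ X) (b : K ⟶ Y) (φ : a ≫ n ≅ b ≫ p) :
    (liftFst a b φ).hom ▷ n ≫ φ.hom =
      ((bipb n p).cell (lift a b φ)).hom ≫ (liftSnd a b φ).hom ▷ p :=
  (liftIso a b φ).hom.w

theorem lift_cell (a : K ⟶ X) (b : K ⟶ Y) (φ : a ≫ n ≅ b ≫ p) :
    ((bipb n p).cell (lift a b φ)).hom =
      (liftFst a b φ).hom ▷ n ≫ φ.hom ≫ (liftSnd a b φ).inv ▷ p := by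
  rw [← Category.assoc, liftFst_cell]
  simp

/-- Compatibility of a pair of 2-cells with the square. -/
abbrev Compat {s t : K ⟶ (bipb n p).pt} (σ : s ≫ (bipb n p).fst ⟶ t ≫ (bipb n p).fst)
    (τ : s ≫ (bipb n p).snd ⟶ t ≫ (bipb n p).snd) : Prop :=
  σ ▷ n ≫ ((bipb n p).cell t).hom = ((bipb n p).cell s).hom ≫ τ ▷ p

def pbHom {s t : K ⟶ (bipb n p).pt} (σ : s ≫ (bipb n p).fst ⟶ t ≫ (bipb n p).fst)
    (τ : s ≫ (bipb n p).snd ⟶ t ≫ (bipb n p).snd) (h : Compat σ τ) :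
    ((bipb n p).toPseudopullback K).obj s ⟶ ((bipb n p).toPseudopullback K).obj t :=
  { fst := σ, snd := τ, w := h }

/-- The 2-cell into the bipullback induced by a compatible pair. -/
def lift₂ {s t : K ⟶ (bipb n p).pt} (σ : s ≫ (bipb n p).fst ⟶ t ≫ (bipb n p).fst)
    (τ : s ≫ (bipb n p).snd ⟶ t ≫ (bipb n p).snd) (h : Compat σ τ) : s ⟶ t :=
  ((bipb n p).toPseudopullback K).preimage (pbHom σ τ h)

@[simp]
theorem lift₂_fst {s t : K ⟶ (bipb n p).pt} (σ : s ≫ (bipb n p).fst ⟶ t ≫ (bipb n p).fst)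
    (τ : s ≫ (bipb n p).snd ⟶ t ≫ (bipb n p).snd) (h : Compat σ τ) :
    lift₂ σ τ h ▷ (bipb n p).fst = σ :=
  congrArg Limits.CategoricalPullback.Hom.fst
    (((bipb n p).toPseudopullback K).map_preimage (pbHom σ τ h))

@[simp]
theorem lift₂_snd {s t : K ⟶ (bipb n p).pt} (σ : s ≫ (bipb n p).fst ⟶ t ≫ (bipb n p).fst)
    (τ : s ≫ (bipb n p).snd ⟶ t ≫ (bipb n p).snd) (h : Compat σ τ) :
    lift₂ σ τ h ▷ (bipb n p).snd = τ :=
  congrArg Limits.CategoricalPullback.Hom.snd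
    (((bipb n p).toPseudopullback K).map_preimage (pbHom σ τ h))

theorem lift₂_ext {s t : K ⟶ (bipb n p).pt} {σ τ : s ⟶ t}
    (h₁ : σ ▷ (bipb n p).fst = τ ▷ (bipb n p).fst) (h₂ : σ ▷ (bipb n p).snd = τ ▷ (bipb n p).snd) :
    σ = τ :=
  ((bipb n p).toPseudopullback K).map_injective (Limits.CategoricalPullback.hom_ext h₁ h₂)

/-- The invertible 2-cell into the bipullback induced by a compatible pair. -/
@[simps]
def lift₂Iso {s t : K ⟶ (bipb n p).pt} (σ : s ≫ (bipb n p).fst ≅ t ≫ (bipb n p).fst)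
    (τ : s ≫ (bipb n p).snd ≅ t ≫ (bipb n p).snd) (h : Compat σ.hom τ.hom) : s ≅ t where
  hom := lift₂ σ.hom τ.hom h
  inv := lift₂ σ.inv τ.inv (by
    have h1 : σ.inv ▷ n ≫ σ.hom ▷ n = 𝟙 _ := by simp [← comp_whiskerRight]
    have h2 : τ.hom ▷ p ≫ τ.inv ▷ p = 𝟙 _ := by simp [← comp_whiskerRight]
    have := congrArg (fun z => σ.inv ▷ n ≫ z ≫ τ.inv ▷ p) h
    simp only [Category.assoc, h2, Category.comp_id, reassoc_of% h1] at this
    simpa [Compat] using this.symm)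
  hom_inv_id := lift₂_ext (by simp) (by simp)
  inv_hom_id := lift₂_ext (by simp) (by simp)

/-- An identification of the square given by whiskering the bipullback with `t`. -/
structure Pres (t : K ⟶ (bipb n p).pt) (a : K ⟶ X) (b : K ⟶ Y) (φ : a ≫ n ≅ b ≫ p) where
  e : t ≫ (bipb n p).fst ≅ a
  f : t ≫ (bipb n p).snd ≅ b
  w : e.hom ▷ n ≫ φ.hom = ((bipb n p).cell t).hom ≫ f.hom ▷ p

/-- The 1-cell `lift a b φ` represents the square `φ`. -/
@[simps]
def liftPres (a : K ⟶ X) (b : K ⟶ Y) (φ : a ≫ n ≅ b ≫ p) : Pres (lift a b φ) a b φ where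
  e := liftFst a b φ
  f := liftSnd a b φ
  w := liftFst_cell a b φ

theorem Pres.compat {t t' : K ⟶ (bipb n p).pt} {a a' : K ⟶ X} {b b' : K ⟶ Y} {φ : a ≫ n ≅ b ≫ p}
    {φ' : a' ≫ n ≅ b' ≫ p} (P : Pres t a b φ) (P' : Pres t' a' b' φ') (α : a ⟶ a') (β : b ⟶ b')
    (h : α ▷ n ≫ φ'.hom = φ.hom ≫ β ▷ p) :
    Compat (P.e.hom ≫ α ≫ P'.e.inv) (P.f.hom ≫ β ≫ P'.f.inv) := by
  have h1 : P'.e.inv ▷ n ≫ ((bipb n p).cell t').hom = φ'.hom ≫ P'.f.inv ▷ p := by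
    have := congrArg (fun z => P'.e.inv ▷ n ≫ z ≫ P'.f.inv ▷ p) P'.w
    simp only [Category.assoc, inv_hom_whiskerRight_assoc, hom_inv_whiskerRight,
      Category.comp_id] at this
    exact this.symm
  simp only [Compat, comp_whiskerRight, Category.assoc]
  rw [h1, reassoc_of% h, reassoc_of% P.w]

/-- The 2-cell between represented 1-cells induced by a morphism of squares. -/
def Pres.hom {t t' : K ⟶ (bipb n p).pt} {a a' : K ⟶ X} {b b' : K ⟶ Y} {φ : a ≫ n ≅ b ≫ p}
    {φ' : a' ≫ n ≅ b' ≫ p} (P : Pres t a b φ) (P' : Pres t' a' b' φ') (α : a ⟶ a') (β : b ⟶ b')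
    (h : α ▷ n ≫ φ'.hom = φ.hom ≫ β ▷ p) : t ⟶ t' :=
  lift₂ (P.e.hom ≫ α ≫ P'.e.inv) (P.f.hom ≫ β ≫ P'.f.inv) (P.compat P' α β h)

/-- The invertible 2-cell between represented 1-cells induced by an isomorphism of squares. -/
def Pres.iso {t t' : K ⟶ (bipb n p).pt} {a a' : K ⟶ X} {b b' : K ⟶ Y} {φ : a ≫ n ≅ b ≫ p}
    {φ' : a' ≫ n ≅ b' ≫ p} (P : Pres t a b φ) (P' : Pres t' a' b' φ') (α : a ≅ a') (β : b ≅ b')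
    (h : α.hom ▷ n ≫ φ'.hom = φ.hom ≫ β.hom ▷ p) : t ≅ t' :=
  lift₂Iso (P.e ≪≫ α ≪≫ P'.e.symm) (P.f ≪≫ β ≪≫ P'.f.symm) (P.compat P' α.hom β.hom h)

section

variable {t t' : K ⟶ (bipb n p).pt} {a a' : K ⟶ X} {b b' : K ⟶ Y} {φ : a ≫ n ≅ b ≫ p}
    {φ' : a' ≫ n ≅ b' ≫ p} (P : Pres t a b φ) (P' : Pres t' a' b' φ')

@[simp]
theorem Pres.hom_fst (α : a ⟶ a') (β : b ⟶ b') (h : α ▷ n ≫ φ'.hom = φ.hom ≫ β ▷ p) :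
    P.hom P' α β h ▷ (bipb n p).fst = P.e.hom ≫ α ≫ P'.e.inv := lift₂_fst _ _ _

@[simp]
theorem Pres.hom_snd (α : a ⟶ a') (β : b ⟶ b') (h : α ▷ n ≫ φ'.hom = φ.hom ≫ β ▷ p) :
    P.hom P' α β h ▷ (bipb n p).snd = P.f.hom ≫ β ≫ P'.f.inv := lift₂_snd _ _ _

variable (α : a ≅ a') (β : b ≅ b') (h : α.hom ▷ n ≫ φ'.hom = φ.hom ≫ β.hom ▷ p)

@[simp]
theorem Pres.iso_hom_fst :
    (P.iso P' α β h).hom ▷ (bipb n p).fst = P.e.hom ≫ α.hom ≫ P'.e.inv := lift₂_fst _ _ _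

@[simp]
theorem Pres.iso_hom_snd :
    (P.iso P' α β h).hom ▷ (bipb n p).snd = P.f.hom ≫ β.hom ≫ P'.f.inv := lift₂_snd _ _ _

@[simp]
theorem Pres.iso_inv_fst :
    (P.iso P' α β h).inv ▷ (bipb n p).fst = P'.e.hom ≫ α.inv ≫ P.e.inv :=
  (lift₂_fst _ _ _).trans (by simp)

@[simp]
theorem Pres.iso_inv_snd :
    (P.iso P' α β h).inv ▷ (bipb n p).snd = P'.f.hom ≫ β.inv ≫ P.f.inv :=
  (lift₂_snd _ _ _).trans (by simp)

theorem Pres.hom_fst_e (α : a ⟶ a') (β : b ⟶ b') (h : α ▷ n ≫ φ'.hom = φ.hom ≫ β ▷ p) :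
    P.hom P' α β h ▷ (bipb n p).fst ≫ P'.e.hom = P.e.hom ≫ α := by simp

theorem Pres.hom_snd_f (α : a ⟶ a') (β : b ⟶ b') (h : α ▷ n ≫ φ'.hom = φ.hom ≫ β ▷ p) :
    P.hom P' α β h ▷ (bipb n p).snd ≫ P'.f.hom = P.f.hom ≫ β := by simp

theorem Pres.iso_hom_fst_e :
    (P.iso P' α β h).hom ▷ (bipb n p).fst ≫ P'.e.hom = P.e.hom ≫ α.hom := by simp

theorem Pres.iso_hom_snd_f :
    (P.iso P' α β h).hom ▷ (bipb n p).snd ≫ P'.f.hom = P.f.hom ≫ β.hom := by simp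

/-- Transport of a representation along an isomorphism of squares. -/
@[simps]
def Pres.trans : Pres t a' b' φ' where
  e := P.e ≪≫ α
  f := P.f ≪≫ β
  w := by simp [h, reassoc_of% P.w]

end

/-- The identity 1-cell represents the bipullback square. -/
@[simps]
def idPres : Pres (𝟙 (bipb n p).pt) (bipb n p).fst (bipb n p).snd (bipb n p).iso where
  e := λ_ _
  f := λ_ _
  w := by simp [Square.cell_hom]

/-- Whiskering of a square. -/
@[simps!]
def whiskerSq {J : A} (s : J ⟶ K) {a : K ⟶ X} {b : K ⟶ Y} (φ : a ≫ n ≅ b ≫ p) :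
    (s ≫ a) ≫ n ≅ (s ≫ b) ≫ p :=
  α_ s a n ≪≫ whiskerLeftIso s φ ≪≫ (α_ s b p).symm

/-- Whiskering of a representation. -/
@[simps]
def Pres.whisker {J : A} (s : J ⟶ K) {t : K ⟶ (bipb n p).pt} {a : K ⟶ X} {b : K ⟶ Y}
    {φ : a ≫ n ≅ b ≫ p} (P : Pres t a b φ) : Pres (s ≫ t) (s ≫ a) (s ≫ b) (whiskerSq s φ) where
  e := α_ _ _ _ ≪≫ whiskerLeftIso s P.e
  f := α_ _ _ _ ≪≫ whiskerLeftIso s P.f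
  w := by
    have := congrArg (fun z => s ◁ z) P.w
    simp only [Square.cell_hom, whiskerLeft_comp, Category.assoc] at this
    simp [Square.cell_hom, reassoc_of% this]

end Limits

section Aux

variable {A : Type u} [Bicategory.{w, v} A]

theorem sq_aux {P P' S S' S'' T T' T'' Y : A} {d : P ⟶ S} {c : P ⟶ T} {d' : P' ⟶ S'} {c' : P' ⟶ T'}
    {L : P ⟶ P'} {h : S ⟶ S'} {h' : S' ⟶ S''} {k : T ⟶ T'} {k' : T' ⟶ T''} {r : S ⟶ Y} {l : T ⟶ Y}
    {r' : S' ⟶ Y} {l' : T' ⟶ Y} {r'' : S'' ⟶ Y} {l'' : T'' ⟶ Y} {θ : d ≫ r ⟶ c ≫ l}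
    {θ' : d' ≫ r' ⟶ c' ≫ l'} {e : L ≫ d' ⟶ d ≫ h} {f : L ≫ c' ⟶ c ≫ k} {ρ : h ≫ r' ⟶ r}
    {ι : l ⟶ k ≫ l'} {ρ' : h' ≫ r'' ⟶ r'} {ι' : l' ⟶ k' ≫ l''}
    (w : e ▷ r' ≫ (α_ _ _ _).hom ≫ d ◁ ρ ≫ θ ≫ c ◁ ι ≫ (α_ _ _ _).inv =
      ((α_ _ _ _).hom ≫ L ◁ θ' ≫ (α_ _ _ _).inv) ≫ f ▷ l') :
    ((α_ L d' h').inv ≫ e ▷ h' ≫ (α_ d h h').hom) ▷ r'' ≫ (α_ _ _ _).hom ≫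
        d ◁ ((α_ h h' r'').hom ≫ h ◁ ρ' ≫ ρ) ≫ θ ≫ c ◁ (ι ≫ k ◁ ι' ≫ (α_ k k' l'').inv) ≫
        (α_ _ _ _).inv =
      ((α_ _ _ _).hom ≫
        L ◁ ((α_ _ _ _).hom ≫ d' ◁ ρ' ≫ θ' ≫ c' ◁ ι' ≫ (α_ _ _ _).inv) ≫ (α_ _ _ _).inv) ≫
        ((α_ L c' k').inv ≫ f ▷ k' ≫ (α_ c k k').hom) ▷ l'' := by
  have h1 : c ◁ ι ≫ c ◁ k ◁ ι' =
      (c ◁ ι ≫ (α_ c k l').inv) ≫ (c ≫ k) ◁ ι' ≫ (α_ c k (k' ≫ l'')).hom := by simp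
  have h2 : e ▷ h' ▷ r'' ≫ (α_ (d ≫ h) h' r'').hom ≫ (α_ d h (h' ≫ r'')).hom ≫ d ◁ h ◁ ρ' =
    (α_ _ _ _).hom ≫ (L ≫ d') ◁ ρ' ≫ e ▷ r' ≫ (α_ _ _ _).hom := by
    rw [whisker_exchange_assoc]; simp
  have h3 : f ▷ l' ≫ (c ≫ k) ◁ ι' = (L ≫ c') ◁ ι' ≫ f ▷ (k' ≫ l'') := (whisker_exchange _ _).symm
  calc _ = (α_ L d' h').inv ▷ r'' ≫ (e ▷ h' ▷ r'' ≫ (α_ (d ≫ h) h' r'').hom ≫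
          (α_ d h (h' ≫ r'')).hom ≫ d ◁ h ◁ ρ') ≫ d ◁ ρ ≫ θ ≫ (c ◁ ι ≫ c ◁ k ◁ ι') ≫
          c ◁ (α_ k k' l'').inv ≫ (α_ _ _ _).inv := by simp
    _ = (α_ L d' h').inv ▷ r'' ≫ ((α_ _ _ _).hom ≫ (L ≫ d') ◁ ρ') ≫ (e ▷ r' ≫ (α_ _ _ _).hom ≫
          d ◁ ρ ≫ θ ≫ c ◁ ι ≫ (α_ c k l').inv) ≫ ((c ≫ k) ◁ ι' ≫ (α_ c k (k' ≫ l'')).hom) ≫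
          c ◁ (α_ k k' l'').inv ≫ (α_ _ _ _).inv := by rw [h1, h2]; simp only [Category.assoc]
    _ = (α_ L d' h').inv ▷ r'' ≫ ((α_ _ _ _).hom ≫ (L ≫ d') ◁ ρ') ≫
          ((α_ _ _ _).hom ≫ L ◁ θ' ≫ (α_ _ _ _).inv) ≫ (f ▷ l' ≫ (c ≫ k) ◁ ι') ≫
          (α_ c k (k' ≫ l'')).hom ≫ c ◁ (α_ k k' l'').inv ≫ (α_ _ _ _).inv := by
        rw [w]; simp only [Category.assoc]
    _ = _ := by rw [h3]; simp

theorem leg_aux {K P S X : A} {d : P ⟶ S} {l : S ⟶ X} {t t' : K ⟶ P} {ω : t ⟶ t'} {a a' : K ⟶ S}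
    {e : t ≫ d ⟶ a} {e' : t' ≫ d ⟶ a'} {α : a ⟶ a'} (hω : ω ▷ d ≫ e' = e ≫ α) {q : K ⟶ X}
    {f : a ≫ l ⟶ q} {f' : a' ≫ l ⟶ q} (hα : α ▷ l ≫ f' = f) :
    ω ▷ (d ≫ l) ≫ (α_ t' d l).inv ≫ e' ▷ l ≫ f' = (α_ t d l).inv ≫ e ▷ l ≫ f := by
  have := congrArg (fun z => z ▷ l) hω
  simp only [comp_whiskerRight] at this
  rw [whiskerRight_comp_assoc, Iso.hom_inv_id_assoc, reassoc_of% this, hα]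

theorem compLam_naturality {P W V K : A} {m : P ⟶ W} {a b : W ⟶ V} (σ : a ⟶ b) {l : V ⟶ K}
    {q : W ⟶ K} {f : a ≫ l ⟶ q} {g : b ≫ l ⟶ q} (w : σ ▷ l ≫ g = f) :
    (m ◁ σ) ▷ l ≫ (α_ _ _ _).hom ≫ m ◁ g = (α_ _ _ _).hom ≫ m ◁ f := by
  simp [← w]

theorem rightUnitor_aux {P X Y : A} (d : P ⟶ X) (l : X ⟶ Y) :
    (ρ_ d).hom ▷ l ≫ 𝟙 (d ≫ l) = (α_ _ _ _).hom ≫ d ◁ (λ_ l).hom := by simp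

theorem leftUnitor_aux {P X Y : A} (d : P ⟶ X) (l : X ⟶ Y) :
    (α_ (𝟙 P) d l).inv ≫ (λ_ d).hom ▷ l ≫ 𝟙 (d ≫ l) = (λ_ (d ≫ l)).hom := by simp

theorem id_aux {P V K : A} {a : P ⟶ V} {l : V ⟶ K} {q : P ⟶ K} (f : a ≫ l ⟶ q) :
    𝟙 a ▷ l ≫ f = f := by simp

theorem compLam_comp {P P' P'' V V' V'' K : A} {d : P ⟶ V} {d' : P' ⟶ V'} {d'' : P'' ⟶ V''}
    {L : P ⟶ P'} {L' : P' ⟶ P''} {h : V ⟶ V'} {h' : V' ⟶ V''} {l : V ⟶ K} {l' : V' ⟶ K} {l'' : V'' ⟶ K}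
    (e : L ≫ d' ⟶ d ≫ h) (e' : L' ≫ d'' ⟶ d' ≫ h') (m : h ≫ l' ⟶ l) (m' : h' ≫ l'' ⟶ l') :
    (α_ L L' (d'' ≫ l'')).hom ≫ L ◁ ((α_ _ _ _).inv ≫ e' ▷ l'' ≫ (α_ _ _ _).hom ≫ d' ◁ m') ≫
        (α_ _ _ _).inv ≫ e ▷ l' ≫ (α_ _ _ _).hom ≫ d ◁ m =
      (α_ (L ≫ L') d'' l'').inv ≫
        (((α_ L L' d'').hom ≫ L ◁ e') ≫ (α_ _ _ _).inv ≫ e ▷ h' ≫ (α_ _ _ _).hom) ▷ l'' ≫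
        (α_ _ _ _).hom ≫ d ◁ ((α_ _ _ _).hom ≫ h ◁ m' ≫ m) := by
  have h2 : e ▷ h' ▷ l'' ≫ (α_ (d ≫ h) h' l'').hom ≫ (α_ d h (h' ≫ l'')).hom ≫ d ◁ h ◁ m' =
    (α_ _ _ _).hom ≫ (L ≫ d') ◁ m' ≫ e ▷ l' ≫ (α_ _ _ _).hom := by
    rw [whisker_exchange_assoc]; simp
  symm
  calc _ = (α_ (L ≫ L') d'' l'').inv ≫ ((α_ L L' d'').hom ≫ L ◁ e' ≫ (α_ _ _ _).inv) ▷ l'' ≫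
        (e ▷ h' ▷ l'' ≫ (α_ (d ≫ h) h' l'').hom ≫ (α_ d h (h' ≫ l'')).hom ≫ d ◁ h ◁ m') ≫ d ◁ m := by
        simp
    _ = _ := by rw [h2]; simp

end Aux

section Over

variable {A : Type u} [Bicategory.{w, v} A] {P P' P'' P''' V V' V'' V''' : A}

/-- The 2-cell `Θ` is compatible with `β` with respect to the identifications `e` and `e'`. -/
def Over {d : P ⟶ V} {d' : P' ⟶ V'} {t t' : P ⟶ P'} {a a' : V ⟶ V'} (e : t ≫ d' ⟶ d ≫ a)
    (e' : t' ≫ d' ⟶ d ≫ a') (Θ : t ⟶ t') (β : a ⟶ a') : Prop :=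
  Θ ▷ d' ≫ e' = e ≫ d ◁ β

theorem Over.id {d : P ⟶ V} {d' : P' ⟶ V'} {t : P ⟶ P'} {a : V ⟶ V'} (e : t ≫ d' ⟶ d ≫ a) :
    Over e e (𝟙 t) (𝟙 a) := by simp [Over]

theorem Over.comp {d : P ⟶ V} {d' : P' ⟶ V'} {t t' t'' : P ⟶ P'} {a a' a'' : V ⟶ V'}
    {e : t ≫ d' ⟶ d ≫ a} {e' : t' ≫ d' ⟶ d ≫ a'} {e'' : t'' ≫ d' ⟶ d ≫ a''} {Θ : t ⟶ t'}
    {Θ' : t' ⟶ t''} {β : a ⟶ a'} {β' : a' ⟶ a''} (H : Over e e' Θ β) (H' : Over e' e'' Θ' β') :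
    Over e e'' (Θ ≫ Θ') (β ≫ β') := by
  unfold Over at *
  rw [comp_whiskerRight, Category.assoc, H', reassoc_of% H, whiskerLeft_comp]

theorem Over.inv {d : P ⟶ V} {d' : P' ⟶ V'} {t t' : P ⟶ P'} {a a' : V ⟶ V'}
    {e : t ≫ d' ⟶ d ≫ a} {e' : t' ≫ d' ⟶ d ≫ a'} {Θ : t ≅ t'} {β : a ≅ a'}
    (H : Over e e' Θ.hom β.hom) : Over e' e Θ.inv β.inv := by
  unfold Over at *
  have := congrArg (fun z => Θ.inv ▷ d' ≫ z ≫ d ◁ β.inv) H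
  simpa using this.symm

theorem Over.unique {d : P ⟶ V} {d' : P' ⟶ V'} {t t' : P ⟶ P'} {a a' : V ⟶ V'}
    {e : t ≫ d' ⟶ d ≫ a} {e' : t' ≫ d' ≅ d ≫ a'} {Θ Θ' : t ⟶ t'} {β β' : a ⟶ a'}
    (H : Over e e'.hom Θ β) (H' : Over e e'.hom Θ' β') (h : β = β') : Θ ▷ d' = Θ' ▷ d' := by
  unfold Over at *
  rw [← cancel_mono e'.hom, H, H', h]

/-- Pasting of two squares. -/
def paste {d : P ⟶ V} {d' : P' ⟶ V'} {d'' : P'' ⟶ V''} {L : P ⟶ P'} {L' : P' ⟶ P''} {h : V ⟶ V'}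
    {h' : V' ⟶ V''} (e : L ≫ d' ⟶ d ≫ h) (e' : L' ≫ d'' ⟶ d' ≫ h') :
    (L ≫ L') ≫ d'' ⟶ d ≫ (h ≫ h') :=
  ((α_ L L' d'').hom ≫ L ◁ e') ≫ (α_ L d' h').inv ≫ e ▷ h' ≫ (α_ d h h').hom

/-- The identity square. -/
def pasteId (d : P ⟶ V) : 𝟙 P ≫ d ⟶ d ≫ 𝟙 V := (λ_ d).hom ≫ (ρ_ d).inv

theorem Over.whiskerLeft {d : P ⟶ V} {d' : P' ⟶ V'} {d'' : P'' ⟶ V''} {L : P ⟶ P'}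
    {L₁ L₂ : P' ⟶ P''} {h : V ⟶ V'} {h₁ h₂ : V' ⟶ V''} (e : L ≫ d' ⟶ d ≫ h)
    {e₁ : L₁ ≫ d'' ⟶ d' ≫ h₁} {e₂ : L₂ ≫ d'' ⟶ d' ≫ h₂} {Θ : L₁ ⟶ L₂} {β : h₁ ⟶ h₂}
    (H : Over e₁ e₂ Θ β) : Over (paste e e₁) (paste e e₂) (L ◁ Θ) (h ◁ β) := by
  unfold Over paste at *
  have h1 : L ◁ Θ ▷ d'' ≫ L ◁ e₂ = L ◁ e₁ ≫ L ◁ d' ◁ β := by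
    rw [← whiskerLeft_comp, H, whiskerLeft_comp]
  have h2 : e ▷ h₁ ≫ (d ≫ h) ◁ β = (L ≫ d') ◁ β ≫ e ▷ h₂ := (whisker_exchange _ _).symm
  calc _ = (α_ _ _ _).hom ≫ (L ◁ Θ ▷ d'' ≫ L ◁ e₂) ≫ (α_ L d' h₂).inv ≫ e ▷ h₂ ≫
        (α_ d h h₂).hom := by simp
    _ = (α_ _ _ _).hom ≫ L ◁ e₁ ≫ (α_ L d' h₁).inv ≫ ((L ≫ d') ◁ β ≫ e ▷ h₂) ≫
        (α_ d h h₂).hom := by rw [h1]; simp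
    _ = _ := by rw [← h2]; simp

theorem Over.whiskerRight {d : P ⟶ V} {d' : P' ⟶ V'} {d'' : P'' ⟶ V''} {L₁ L₂ : P ⟶ P'}
    {L : P' ⟶ P''} {h₁ h₂ : V ⟶ V'} {h : V' ⟶ V''} {e₁ : L₁ ≫ d' ⟶ d ≫ h₁}
    {e₂ : L₂ ≫ d' ⟶ d ≫ h₂} (e : L ≫ d'' ⟶ d' ≫ h) {Θ : L₁ ⟶ L₂} {β : h₁ ⟶ h₂}
    (H : Over e₁ e₂ Θ β) : Over (paste e₁ e) (paste e₂ e) (Θ ▷ L) (β ▷ h) := by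
  unfold Over paste at *
  have h1 : Θ ▷ d' ▷ h ≫ e₂ ▷ h = e₁ ▷ h ≫ (d ◁ β) ▷ h := by
    rw [← comp_whiskerRight, H, comp_whiskerRight]
  have h2 : Θ ▷ (L ≫ d'') ≫ L₂ ◁ e = L₁ ◁ e ≫ Θ ▷ (d' ≫ h) := (whisker_exchange _ _).symm
  calc _ = (α_ _ _ _).hom ≫ (Θ ▷ (L ≫ d'') ≫ L₂ ◁ e) ≫ (α_ L₂ d' h).inv ≫ e₂ ▷ h ≫
        (α_ d h₂ h).hom := by simp
    _ = (α_ _ _ _).hom ≫ L₁ ◁ e ≫ (α_ _ _ _).inv ≫ (Θ ▷ d' ▷ h ≫ e₂ ▷ h) ≫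
        (α_ d h₂ h).hom := by rw [h2]; simp
    _ = _ := by rw [h1]; simp

theorem Over.associator {d : P ⟶ V} {d' : P' ⟶ V'} {d'' : P'' ⟶ V''} {d''' : P''' ⟶ V'''}
    {L : P ⟶ P'} {L' : P' ⟶ P''} {L'' : P'' ⟶ P'''} {h : V ⟶ V'} {h' : V' ⟶ V''} {h'' : V'' ⟶ V'''}
    (e : L ≫ d' ⟶ d ≫ h) (e' : L' ≫ d'' ⟶ d' ≫ h') (e'' : L'' ≫ d''' ⟶ d'' ≫ h'') :
    Over (paste (paste e e') e'') (paste e (paste e' e'')) (α_ L L' L'').hom (α_ h h' h'').hom := by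
  unfold Over paste
  simp

theorem Over.leftUnitor {d : P ⟶ V} {d' : P' ⟶ V'} {L : P ⟶ P'} {h : V ⟶ V'}
    (e : L ≫ d' ⟶ d ≫ h) : Over (paste (pasteId d) e) e (λ_ L).hom (λ_ h).hom := by
  unfold Over paste pasteId
  simp

theorem Over.rightUnitor {d : P ⟶ V} {d' : P' ⟶ V'} {L : P ⟶ P'} {h : V ⟶ V'}
    (e : L ≫ d' ⟶ d ≫ h) : Over (paste e (pasteId d')) e (ρ_ L).hom (ρ_ h).hom := by
  unfold Over paste pasteId
  simp

end Over

section Spans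

variable {A : Type u} [Bicategory.{w, v} A]

/-- A span from `X` to `Y` with left leg `l` and right leg `r`. -/
structure Spn (X Y : A) where
  apex : A
  l : apex ⟶ X
  r : apex ⟶ Y

namespace Spn

variable {X Y Z : A}

/-- A morphism of spans: a 1-cell between the apices commuting with the legs up to specified
invertible 2-cells. -/
structure Hom (S T : Spn X Y) where
  map : S.apex ⟶ T.apex
  lam : map ≫ T.l ≅ S.l
  rho : map ≫ T.r ≅ S.r

/-- A 2-cell between morphisms of spans: a 2-cell compatible with those in the triangles. -/
@[ext]
structure Hom₂ {S T : Spn X Y} (f g : Hom S T) where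
  cell : f.map ⟶ g.map
  lam_w : cell ▷ T.l ≫ g.lam.hom = f.lam.hom
  rho_w : cell ▷ T.r ≫ g.rho.hom = f.rho.hom

attribute [simp] Hom₂.lam_w Hom₂.rho_w

instance : CategoryStruct (Spn X Y) where
  Hom := Hom
  id S := ⟨𝟙 S.apex, λ_ S.l, λ_ S.r⟩
  comp f g :=
    ⟨f.map ≫ g.map, α_ _ _ _ ≪≫ whiskerLeftIso f.map g.lam ≪≫ f.lam,
      α_ _ _ _ ≪≫ whiskerLeftIso f.map g.rho ≪≫ f.rho⟩

section

variable {S T U : Spn X Y} (f : S ⟶ T) (g : T ⟶ U)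

@[simp] theorem id_map : Hom.map (𝟙 S) = 𝟙 S.apex := rfl

@[simp] theorem id_lam_hom : (Hom.lam (𝟙 S)).hom = (λ_ S.l).hom := rfl

@[simp] theorem id_lam_inv : (Hom.lam (𝟙 S)).inv = (λ_ S.l).inv := rfl

@[simp] theorem id_rho_hom : (Hom.rho (𝟙 S)).hom = (λ_ S.r).hom := rfl

@[simp] theorem comp_map : Hom.map (f ≫ g) = Hom.map f ≫ Hom.map g := rfl

@[simp] theorem comp_lam_hom : (Hom.lam (f ≫ g)).hom =
    (α_ f.map g.map U.l).hom ≫ f.map ◁ g.lam.hom ≫ f.lam.hom := rfl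

@[simp] theorem comp_lam_inv : (Hom.lam (f ≫ g)).inv =
    f.lam.inv ≫ f.map ◁ g.lam.inv ≫ (α_ f.map g.map U.l).inv :=
  (Category.assoc _ _ _)

@[simp] theorem comp_rho_hom : (Hom.rho (f ≫ g)).hom =
    (α_ f.map g.map U.r).hom ≫ f.map ◁ g.rho.hom ≫ f.rho.hom := rfl

end

instance (S T : Spn X Y) : Category (S ⟶ T) where
  Hom f g := Hom₂ f g
  id f := ⟨𝟙 f.map, by simp, by simp⟩
  comp σ τ := ⟨σ.cell ≫ τ.cell, by simp, by simp⟩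

section

variable {S T : Spn X Y} {f g h : S ⟶ T}

/-- The underlying 2-cell. -/
def cell (σ : f ⟶ g) : f.map ⟶ g.map := Hom₂.cell σ

@[simp]
theorem cell_lam (σ : f ⟶ g) : cell σ ▷ T.l ≫ g.lam.hom = f.lam.hom := Hom₂.lam_w σ

@[simp]
theorem cell_rho (σ : f ⟶ g) : cell σ ▷ T.r ≫ g.rho.hom = f.rho.hom := Hom₂.rho_w σ

@[simp]
theorem lam_inv_cell (σ : f ⟶ g) : f.lam.inv ≫ cell σ ▷ T.l = g.lam.inv := by
  rw [Iso.inv_comp_eq, Iso.eq_comp_inv, cell_lam σ]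

@[simp]
theorem rho_inv_cell (σ : f ⟶ g) : f.rho.inv ≫ cell σ ▷ T.r = g.rho.inv := by
  rw [Iso.inv_comp_eq, Iso.eq_comp_inv, cell_rho σ]

/-- A 2-cell of spans from its underlying 2-cell. -/
def mkHom₂ (f g : S ⟶ T) (σ : f.map ⟶ g.map) (h₁ : σ ▷ T.l ≫ g.lam.hom = f.lam.hom)
    (h₂ : σ ▷ T.r ≫ g.rho.hom = f.rho.hom) : f ⟶ g := Hom₂.mk σ h₁ h₂

@[simp]
theorem cell_mkHom₂ (σ : f.map ⟶ g.map) (h₁ : σ ▷ T.l ≫ g.lam.hom = f.lam.hom)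
    (h₂ : σ ▷ T.r ≫ g.rho.hom = f.rho.hom) : cell (mkHom₂ f g σ h₁ h₂) = σ := rfl

@[simp] theorem cell_id : cell (𝟙 f) = 𝟙 f.map := rfl

@[simp] theorem cell_comp (σ : f ⟶ g) (τ : g ⟶ h) : cell (σ ≫ τ) = cell σ ≫ cell τ := rfl

@[ext]
theorem hom₂_ext {σ τ : f ⟶ g} (h : cell σ = cell τ) : σ = τ := Hom₂.ext h

/-- An invertible 2-cell of spans from an invertible 2-cell compatible with the triangles. -/
@[simps]
def mkIso (f g : S ⟶ T) (e : f.map ≅ g.map) (h₁ : e.hom ▷ T.l ≫ g.lam.hom = f.lam.hom)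
    (h₂ : e.hom ▷ T.r ≫ g.rho.hom = f.rho.hom) : f ≅ g where
  hom := mkHom₂ f g e.hom h₁ h₂
  inv := mkHom₂ g f e.inv (by simp [← h₁]) (by simp [← h₂])
  hom_inv_id := by ext; simp
  inv_hom_id := by ext; simp

end

theorem whisker_aux {K P Q : A} {a b : K ⟶ P} (σ : a ⟶ b) {h : P ⟶ Q} {l : Q ⟶ X} {m : P ⟶ X}
    (e : h ≫ l ⟶ m) {n : K ⟶ X} {f : a ≫ m ⟶ n} {g : b ≫ m ⟶ n} (w : σ ▷ m ≫ g = f) :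
    σ ▷ h ▷ l ≫ (α_ b h l).hom ≫ b ◁ e ≫ g = (α_ a h l).hom ≫ a ◁ e ≫ f := by
  rw [associator_naturality_left_assoc, ← whisker_exchange_assoc, w]

/-- The bicategory of spans from `X` to `Y`. -/
instance : Bicategory (Spn X Y) where
  whiskerLeft f g h σ := mkHom₂ (f ≫ g) (f ≫ h) (f.map ◁ cell σ)
    (by simp [← whiskerLeft_comp_assoc]) (by simp [← whiskerLeft_comp_assoc])
  whiskerRight {_ _ _ f g} σ h := mkHom₂ (f ≫ h) (g ≫ h) (cell σ ▷ h.map)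
    (whisker_aux (cell σ) h.lam.hom (cell_lam σ)) (whisker_aux (cell σ) h.rho.hom (cell_rho σ))
  associator f g h := mkIso ((f ≫ g) ≫ h) (f ≫ g ≫ h) (α_ f.map g.map h.map) (by simp) (by simp)
  leftUnitor f := mkIso (𝟙 _ ≫ f) f (λ_ f.map) (by simp) (by simp)
  rightUnitor f := mkIso (f ≫ 𝟙 _) f (ρ_ f.map) (by simp) (by simp)
  whiskerLeft_id f g := by apply hom₂_ext; exact Bicategory.whiskerLeft_id f.map g.map
  whiskerLeft_comp f _ _ _ σ τ := by apply hom₂_ext; exact Bicategory.whiskerLeft_comp f.map (cell σ) (cell τ)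
  id_whiskerLeft σ := by apply hom₂_ext; exact Bicategory.id_whiskerLeft (cell σ)
  comp_whiskerLeft f g _ _ σ := by apply hom₂_ext; exact Bicategory.comp_whiskerLeft f.map g.map (cell σ)
  id_whiskerRight f g := by apply hom₂_ext; exact Bicategory.id_whiskerRight f.map g.map
  comp_whiskerRight σ τ h := by apply hom₂_ext; exact Bicategory.comp_whiskerRight (cell σ) (cell τ) h.map
  whiskerRight_id σ := by apply hom₂_ext; exact Bicategory.whiskerRight_id (cell σ)
  whiskerRight_comp σ g h := by apply hom₂_ext; exact Bicategory.whiskerRight_comp (cell σ) g.map h.map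
  whisker_assoc f _ _ σ h := by apply hom₂_ext; exact Bicategory.whisker_assoc f.map (cell σ) h.map
  whisker_exchange σ τ := by apply hom₂_ext; exact Bicategory.whisker_exchange (cell σ) (cell τ)
  pentagon f g h i := by apply hom₂_ext; exact Bicategory.pentagon f.map g.map h.map i.map
  triangle f g := by apply hom₂_ext; exact Bicategory.triangle f.map g.map

section

variable {S T U V : Spn X Y}

@[simp] theorem cell_whiskerLeft (f : S ⟶ T) {g h : T ⟶ U} (σ : g ⟶ h) :
    cell (f := f ≫ g) (g := f ≫ h) (f ◁ σ) = f.map ◁ cell σ := rfl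

@[simp] theorem cell_whiskerRight {f g : S ⟶ T} (σ : f ⟶ g) (h : T ⟶ U) :
    cell (f := f ≫ h) (g := g ≫ h) (σ ▷ h) = cell σ ▷ h.map := rfl

variable (f : S ⟶ T) (g : T ⟶ U) (h : U ⟶ V)

@[simp] theorem cell_associator_hom : cell (f := (f ≫ g) ≫ h) (g := f ≫ g ≫ h) (α_ f g h).hom = (α_ f.map g.map h.map).hom := rfl

@[simp] theorem cell_associator_inv : cell (f := f ≫ g ≫ h) (g := (f ≫ g) ≫ h) (α_ f g h).inv = (α_ f.map g.map h.map).inv := rfl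

@[simp] theorem cell_leftUnitor_hom : cell (f := 𝟙 S ≫ f) (g := f) (λ_ f).hom = (λ_ f.map).hom := rfl

@[simp] theorem cell_leftUnitor_inv : cell (f := f) (g := 𝟙 S ≫ f) (λ_ f).inv = (λ_ f.map).inv := rfl

@[simp] theorem cell_rightUnitor_hom : cell (f := f ≫ 𝟙 T) (g := f) (ρ_ f).hom = (ρ_ f.map).hom := rfl

@[simp] theorem cell_rightUnitor_inv : cell (f := f) (g := f ≫ 𝟙 T) (ρ_ f).inv = (ρ_ f.map).inv := rfl

end

end Spn

end Spans

section Composition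

variable {A : Type u} [Bicategory.{w, v} A] [FinitelyComplete A] {X Y Z : A}

namespace Spn

/-- Composition of spans by bipullback. -/
abbrev comp (S : Spn X Y) (T : Spn Y Z) : Spn X Z where
  apex := (bipb S.r T.l).pt
  l := (bipb S.r T.l).fst ≫ S.l
  r := (bipb S.r T.l).snd ≫ T.r

/-- The square that induces the composite of two morphisms of spans. -/
def compSq {S S' : Spn X Y} {T T' : Spn Y Z} (h : S ⟶ S') (k : T ⟶ T') :
    ((bipb S.r T.l).fst ≫ h.map) ≫ S'.r ≅ ((bipb S.r T.l).snd ≫ k.map) ≫ T'.l :=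
  α_ _ _ _ ≪≫ whiskerLeftIso _ h.rho ≪≫ (bipb S.r T.l).iso ≪≫
    (whiskerLeftIso _ k.lam).symm ≪≫ (α_ _ _ _).symm

/-- Horizontal composition of morphisms of spans. -/
def comp₁ {S S' : Spn X Y} {T T' : Spn Y Z} (h : S ⟶ S') (k : T ⟶ T') :
    comp S T ⟶ comp S' T' where
  map := lift _ _ (compSq h k)
  lam := (α_ _ _ _).symm ≪≫ whiskerRightIso (liftFst _ _ (compSq h k)) S'.l ≪≫ α_ _ _ _ ≪≫
    whiskerLeftIso _ h.lam
  rho := (α_ _ _ _).symm ≪≫ whiskerRightIso (liftSnd _ _ (compSq h k)) T'.r ≪≫ α_ _ _ _ ≪≫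
    whiskerLeftIso _ k.rho

section

variable {S S' : Spn X Y} {T T' : Spn Y Z} (h : S ⟶ S') (k : T ⟶ T')

theorem compSq_hom : (compSq h k).hom = (α_ _ _ _).hom ≫ (bipb S.r T.l).fst ◁ h.rho.hom ≫
    (bipb S.r T.l).iso.hom ≫ (bipb S.r T.l).snd ◁ k.lam.inv ≫ (α_ _ _ _).inv := rfl

@[simp]
theorem comp₁_map : (comp₁ h k).map = lift _ _ (compSq h k) := rfl

@[simp]
theorem comp₁_lam_hom : (comp₁ h k).lam.hom = (α_ _ (bipb S'.r T'.l).fst S'.l).inv ≫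
    (liftFst _ _ (compSq h k)).hom ▷ S'.l ≫ (α_ _ _ _).hom ≫ (bipb S.r T.l).fst ◁ h.lam.hom := rfl

@[simp]
theorem comp₁_rho_hom : (comp₁ h k).rho.hom = (α_ _ (bipb S'.r T'.l).snd T'.r).inv ≫
    (liftSnd _ _ (compSq h k)).hom ▷ T'.r ≫ (α_ _ _ _).hom ≫ (bipb S.r T.l).snd ◁ k.rho.hom := rfl

end

theorem compSq_naturality {S S' : Spn X Y} {T T' : Spn Y Z} {h h' : S ⟶ S'} {k k' : T ⟶ T'}
    (σ : h ⟶ h') (τ : k ⟶ k') :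
    ((bipb S.r T.l).fst ◁ cell σ) ▷ S'.r ≫ (compSq h' k').hom =
      (compSq h k).hom ≫ ((bipb S.r T.l).snd ◁ cell τ) ▷ T'.l := by
  simp [compSq_hom, ← whiskerLeft_comp_assoc]

/-- Horizontal composition of 2-cells between morphisms of spans. -/
def comp₂ {S S' : Spn X Y} {T T' : Spn Y Z} {h h' : S ⟶ S'} {k k' : T ⟶ T'}
    (σ : h ⟶ h') (τ : k ⟶ k') : comp₁ h k ⟶ comp₁ h' k' :=
  mkHom₂ _ _
    ((liftPres _ _ (compSq h k)).hom (liftPres _ _ (compSq h' k')) (_ ◁ cell σ) (_ ◁ cell τ)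
      (compSq_naturality σ τ))
    (leg_aux (Pres.hom_fst_e _ _ _ _ _) (compLam_naturality _ (cell_lam σ)))
    (leg_aux (Pres.hom_snd_f _ _ _ _ _) (compLam_naturality _ (cell_rho τ)))

theorem compSq_id (S : Spn X Y) (T : Spn Y Z) :
    (ρ_ (bipb S.r T.l).fst).hom ▷ S.r ≫ (bipb S.r T.l).iso.hom =
      (compSq (𝟙 S) (𝟙 T)).hom ≫ (ρ_ (bipb S.r T.l).snd).hom ▷ T.l := by
  rw [compSq_hom, id_lam_inv]
  simp

/-- Horizontal composition preserves identities up to an invertible 2-cell. -/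
def comp₁Id (S : Spn X Y) (T : Spn Y Z) : comp₁ (𝟙 S) (𝟙 T) ≅ 𝟙 (comp S T) :=
  mkIso _ _ ((liftPres _ _ (compSq (𝟙 S) (𝟙 T))).iso idPres (ρ_ _) (ρ_ _) (compSq_id S T))
    ((congrArg _ (leftUnitor_aux _ _).symm).trans
      (leg_aux (Pres.iso_hom_fst_e _ _ _ _ _) (rightUnitor_aux _ _)))
    ((congrArg _ (leftUnitor_aux _ _).symm).trans
      (leg_aux (Pres.iso_hom_snd_f _ _ _ _ _) (rightUnitor_aux _ _)))

section

variable {S S' S'' : Spn X Y} {T T' T'' : Spn Y Z} (h : S ⟶ S') (h' : S' ⟶ S'') (k : T ⟶ T')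
  (k' : T' ⟶ T'')

def compFst : (comp₁ h k).map ≫ (bipb S'.r T'.l).fst ≫ h'.map ≅
    (bipb S.r T.l).fst ≫ (h ≫ h').map :=
  (α_ _ _ _).symm ≪≫ whiskerRightIso (liftFst _ _ (compSq h k)) h'.map ≪≫ α_ _ _ _

def compSnd : (comp₁ h k).map ≫ (bipb S'.r T'.l).snd ≫ k'.map ≅
    (bipb S.r T.l).snd ≫ (k ≫ k').map :=
  (α_ _ _ _).symm ≪≫ whiskerRightIso (liftSnd _ _ (compSq h k)) k'.map ≪≫ α_ _ _ _

theorem compFst_hom : (compFst h h' k).hom = (α_ _ _ _).inv ≫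
    (liftFst _ _ (compSq h k)).hom ▷ h'.map ≫ (α_ _ _ _).hom := rfl

theorem compSnd_hom : (compSnd h k k').hom = (α_ _ _ _).inv ≫
    (liftSnd _ _ (compSq h k)).hom ▷ k'.map ≫ (α_ _ _ _).hom := rfl

theorem compSq_comp :
    (compFst h h' k).hom ▷ S''.r ≫ (compSq (h ≫ h') (k ≫ k')).hom =
      (whiskerSq (comp₁ h k).map (compSq h' k')).hom ≫ (compSnd h k k').hom ▷ T''.l := by
  rw [compSq_hom, comp_lam_inv]
  exact sq_aux (liftFst_cell _ _ (compSq h k))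

/-- The composite of horizontal composites represents the square of the composites. -/
def compPres : Pres ((comp₁ h k).map ≫ (comp₁ h' k').map) _ _ (compSq (h ≫ h') (k ≫ k')) :=
  ((liftPres _ _ (compSq h' k')).whisker (comp₁ h k).map).trans (compFst h h' k) (compSnd h k k')
    (compSq_comp h h' k k')

theorem comp₁_comp_lam : (comp₁ h k ≫ comp₁ h' k').lam.hom =
    (α_ _ (bipb S''.r T''.l).fst S''.l).inv ≫ (compPres h h' k k').e.hom ▷ S''.l ≫
      (α_ _ _ _).hom ≫ (bipb S.r T.l).fst ◁ (h ≫ h').lam.hom :=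
  compLam_comp _ _ _ _

theorem comp₁_comp_rho : (comp₁ h k ≫ comp₁ h' k').rho.hom =
    (α_ _ (bipb S''.r T''.l).snd T''.r).inv ≫ (compPres h h' k k').f.hom ▷ T''.r ≫
      (α_ _ _ _).hom ≫ (bipb S.r T.l).snd ◁ (k ≫ k').rho.hom :=
  compLam_comp _ _ _ _

/-- Horizontal composition preserves composition up to an invertible 2-cell. -/
def comp₁Comp : comp₁ (h ≫ h') (k ≫ k') ≅ comp₁ h k ≫ comp₁ h' k' :=
  mkIso _ _ ((liftPres _ _ (compSq (h ≫ h') (k ≫ k'))).iso (compPres h h' k k')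
    (Iso.refl _) (Iso.refl _) (by simp))
    (by rw [comp₁_comp_lam]; exact leg_aux (Pres.iso_hom_fst_e _ _ _ _ _) (id_aux _))
    (by rw [comp₁_comp_rho]; exact leg_aux (Pres.iso_hom_snd_f _ _ _ _ _) (id_aux _))

end

end Spn

end Composition

section CompositionPseudofunctor

variable {A : Type u} [Bicategory.{w, v} A] [FinitelyComplete A] {X Y Z : A}

namespace Spn

/-- The identification of the first component of `comp₁ h k`. -/
def comp₁Fst {S S' : Spn X Y} {T T' : Spn Y Z} (h : S ⟶ S') (k : T ⟶ T') :
    (comp₁ h k).map ≫ (bipb S'.r T'.l).fst ≅ (bipb S.r T.l).fst ≫ h.map :=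
  liftFst _ _ (compSq h k)

/-- The identification of the second component of `comp₁ h k`. -/
def comp₁Snd {S S' : Spn X Y} {T T' : Spn Y Z} (h : S ⟶ S') (k : T ⟶ T') :
    (comp₁ h k).map ≫ (bipb S'.r T'.l).snd ≅ (bipb S.r T.l).snd ≫ k.map :=
  liftSnd _ _ (compSq h k)

theorem comp₂_overFst {S S' : Spn X Y} {T T' : Spn Y Z} {h h' : S ⟶ S'} {k k' : T ⟶ T'}
    (σ : h ⟶ h') (τ : k ⟶ k') :
    Over (comp₁Fst h k).hom (comp₁Fst h' k').hom (cell (comp₂ σ τ)) (cell σ) :=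
  Pres.hom_fst_e (liftPres _ _ (compSq h k)) (liftPres _ _ (compSq h' k')) _ _
    (compSq_naturality σ τ)

theorem comp₂_overSnd {S S' : Spn X Y} {T T' : Spn Y Z} {h h' : S ⟶ S'} {k k' : T ⟶ T'}
    (σ : h ⟶ h') (τ : k ⟶ k') :
    Over (comp₁Snd h k).hom (comp₁Snd h' k').hom (cell (comp₂ σ τ)) (cell τ) :=
  Pres.hom_snd_f (liftPres _ _ (compSq h k)) (liftPres _ _ (compSq h' k')) _ _
    (compSq_naturality σ τ)

theorem comp₁Id_overFst (S : Spn X Y) (T : Spn Y Z) :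
    Over (comp₁Fst (𝟙 S) (𝟙 T)).hom (pasteId _) (cell (comp₁Id S T).hom) (𝟙 (𝟙 S.apex)) := by
  have := Pres.iso_hom_fst_e (liftPres _ _ (compSq (𝟙 S) (𝟙 T))) idPres (ρ_ _) (ρ_ _)
    (compSq_id S T)
  have h2 := congrArg (· ≫ (ρ_ _).inv) this
  refine Eq.trans ((Category.assoc _ _ _).symm.trans h2) ?_
  refine (Category.assoc _ _ _).trans (congrArg ((comp₁Fst (𝟙 S) (𝟙 T)).hom ≫ ·) ?_)
  exact (Iso.hom_inv_id _).trans (Bicategory.whiskerLeft_id _ _).symm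

theorem comp₁Id_overSnd (S : Spn X Y) (T : Spn Y Z) :
    Over (comp₁Snd (𝟙 S) (𝟙 T)).hom (pasteId _) (cell (comp₁Id S T).hom) (𝟙 (𝟙 T.apex)) := by
  have := Pres.iso_hom_snd_f (liftPres _ _ (compSq (𝟙 S) (𝟙 T))) idPres (ρ_ _) (ρ_ _)
    (compSq_id S T)
  have h2 := congrArg (· ≫ (ρ_ _).inv) this
  refine Eq.trans ((Category.assoc _ _ _).symm.trans h2) ?_
  refine (Category.assoc _ _ _).trans (congrArg ((comp₁Snd (𝟙 S) (𝟙 T)).hom ≫ ·) ?_)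
  exact (Iso.hom_inv_id _).trans (Bicategory.whiskerLeft_id _ _).symm

section

variable {S S' S'' : Spn X Y} {T T' T'' : Spn Y Z} (h : S ⟶ S') (h' h₂' : S' ⟶ S'') (k : T ⟶ T')
  (k' : T' ⟶ T'')

theorem comp₁Comp_overFst :
    Over (comp₁Fst (h ≫ h') (k ≫ k')).hom (paste (comp₁Fst h k).hom (comp₁Fst h' k').hom)
      (cell (comp₁Comp h h' k k').hom) (𝟙 (h.map ≫ h'.map)) := by
  refine (Pres.iso_hom_fst_e (liftPres _ _ (compSq (h ≫ h') (k ≫ k'))) (compPres h h' k k')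
    (Iso.refl _) (Iso.refl _) (by simp)).trans
    (congrArg ((comp₁Fst (h ≫ h') (k ≫ k')).hom ≫ ·) ?_)
  exact (Bicategory.whiskerLeft_id _ _).symm

theorem comp₁Comp_overSnd :
    Over (comp₁Snd (h ≫ h') (k ≫ k')).hom (paste (comp₁Snd h k).hom (comp₁Snd h' k').hom)
      (cell (comp₁Comp h h' k k').hom) (𝟙 (k.map ≫ k'.map)) := by
  refine (Pres.iso_hom_snd_f (liftPres _ _ (compSq (h ≫ h') (k ≫ k'))) (compPres h h' k k')
    (Iso.refl _) (Iso.refl _) (by simp)).trans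
    (congrArg ((comp₁Snd (h ≫ h') (k ≫ k')).hom ≫ ·) ?_)
  exact (Bicategory.whiskerLeft_id _ _).symm

end

theorem ext_comp {S : Spn X Y} {T : Spn Y Z} {W : Spn X Z} {f g : W ⟶ S.comp T} {α β : f ⟶ g}
    (h₁ : cell α ▷ (bipb S.r T.l).fst = cell β ▷ (bipb S.r T.l).fst)
    (h₂ : cell α ▷ (bipb S.r T.l).snd = cell β ▷ (bipb S.r T.l).snd) : α = β :=
  hom₂_ext (lift₂_ext h₁ h₂)

/-- The cell of an invertible 2-cell. -/
@[simps]
def cellIso {S T : Spn X Y} {f g : S ⟶ T} (e : f ≅ g) : f.map ≅ g.map where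
  hom := cell e.hom
  inv := cell e.inv
  hom_inv_id := by rw [← cell_comp, e.hom_inv_id, cell_id]
  inv_hom_id := by rw [← cell_comp, e.inv_hom_id, cell_id]

theorem comp₂_id {S S' : Spn X Y} {T T' : Spn Y Z} (h : S ⟶ S') (k : T ⟶ T') :
    comp₂ (𝟙 h) (𝟙 k) = 𝟙 (comp₁ h k) :=
  ext_comp ((comp₂_overFst (𝟙 h) (𝟙 k)).unique (Over.id _) rfl)
    ((comp₂_overSnd (𝟙 h) (𝟙 k)).unique (Over.id _) rfl)

theorem comp₂_comp {S S' : Spn X Y} {T T' : Spn Y Z} {h h' h'' : S ⟶ S'} {k k' k'' : T ⟶ T'}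
    (σ : h ⟶ h') (τ : k ⟶ k') (σ' : h' ⟶ h'') (τ' : k' ⟶ k'') :
    comp₂ (σ ≫ σ') (τ ≫ τ') = comp₂ σ τ ≫ comp₂ σ' τ' :=
  ext_comp
    ((comp₂_overFst _ _).unique ((comp₂_overFst σ τ).comp (comp₂_overFst σ' τ')) rfl)
    ((comp₂_overSnd _ _).unique ((comp₂_overSnd σ τ).comp (comp₂_overSnd σ' τ')) rfl)

theorem comp₁Comp_inv_overFst {S S' S'' : Spn X Y} {T T' T'' : Spn Y Z} (h : S ⟶ S')
    (h' : S' ⟶ S'') (k : T ⟶ T') (k' : T' ⟶ T'') :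
    Over (paste (comp₁Fst h k).hom (comp₁Fst h' k').hom) (comp₁Fst (h ≫ h') (k ≫ k')).hom
      (cell (comp₁Comp h h' k k').inv) (𝟙 (h.map ≫ h'.map)) :=
  Over.inv (Θ := cellIso (comp₁Comp h h' k k')) (β := Iso.refl _) (comp₁Comp_overFst h h' k k')

theorem comp₁Comp_inv_overSnd {S S' S'' : Spn X Y} {T T' T'' : Spn Y Z} (h : S ⟶ S')
    (h' : S' ⟶ S'') (k : T ⟶ T') (k' : T' ⟶ T'') :
    Over (paste (comp₁Snd h k).hom (comp₁Snd h' k').hom) (comp₁Snd (h ≫ h') (k ≫ k')).hom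
      (cell (comp₁Comp h h' k k').inv) (𝟙 (k.map ≫ k'.map)) :=
  Over.inv (Θ := cellIso (comp₁Comp h h' k k')) (β := Iso.refl _) (comp₁Comp_overSnd h h' k k')

theorem comp₂_whiskerLeft {S S' S'' : Spn X Y} {T T' T'' : Spn Y Z} (h : S ⟶ S') (k : T ⟶ T')
    {h₁ h₂ : S' ⟶ S''} {k₁ k₂ : T' ⟶ T''} (σ : h₁ ⟶ h₂) (τ : k₁ ⟶ k₂) :
    comp₂ (h ◁ σ) (k ◁ τ) =
      (comp₁Comp h h₁ k k₁).hom ≫ comp₁ h k ◁ comp₂ σ τ ≫ (comp₁Comp h h₂ k k₂).inv :=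
  ext_comp
    ((comp₂_overFst (h ◁ σ) (k ◁ τ)).unique ((comp₁Comp_overFst h h₁ k k₁).comp
      (((comp₂_overFst σ τ).whiskerLeft _).comp (comp₁Comp_inv_overFst h h₂ k k₂)))
      (by simp))
    ((comp₂_overSnd (h ◁ σ) (k ◁ τ)).unique ((comp₁Comp_overSnd h h₁ k k₁).comp
      (((comp₂_overSnd σ τ).whiskerLeft _).comp (comp₁Comp_inv_overSnd h h₂ k k₂)))
      (by simp))

theorem comp₂_whiskerRight {S S' S'' : Spn X Y} {T T' T'' : Spn Y Z} {h₁ h₂ : S ⟶ S'}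
    {k₁ k₂ : T ⟶ T'} (σ : h₁ ⟶ h₂) (τ : k₁ ⟶ k₂) (h : S' ⟶ S'') (k : T' ⟶ T'') :
    comp₂ (σ ▷ h) (τ ▷ k) =
      (comp₁Comp h₁ h k₁ k).hom ≫ comp₂ σ τ ▷ comp₁ h k ≫ (comp₁Comp h₂ h k₂ k).inv :=
  ext_comp
    ((comp₂_overFst (σ ▷ h) (τ ▷ k)).unique ((comp₁Comp_overFst h₁ h k₁ k).comp
      (((comp₂_overFst σ τ).whiskerRight _).comp (comp₁Comp_inv_overFst h₂ h k₂ k)))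
      (by simp))
    ((comp₂_overSnd (σ ▷ h) (τ ▷ k)).unique ((comp₁Comp_overSnd h₁ h k₁ k).comp
      (((comp₂_overSnd σ τ).whiskerRight _).comp (comp₁Comp_inv_overSnd h₂ h k₂ k)))
      (by simp))

theorem comp₂_associator {S₀ S₁ S₂ S₃ : Spn X Y} {T₀ T₁ T₂ T₃ : Spn Y Z} (f : S₀ ⟶ S₁)
    (g : S₁ ⟶ S₂) (h : S₂ ⟶ S₃) (f' : T₀ ⟶ T₁) (g' : T₁ ⟶ T₂) (h' : T₂ ⟶ T₃) :
    comp₂ (α_ f g h).hom (α_ f' g' h').hom =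
      (comp₁Comp (f ≫ g) h (f' ≫ g') h').hom ≫ (comp₁Comp f g f' g').hom ▷ comp₁ h h' ≫
        (α_ _ _ _).hom ≫ comp₁ f f' ◁ (comp₁Comp g h g' h').inv ≫
        (comp₁Comp f (g ≫ h) f' (g' ≫ h')).inv :=
  ext_comp
    ((comp₂_overFst (α_ f g h).hom (α_ f' g' h').hom).unique
      ((comp₁Comp_overFst (f ≫ g) h (f' ≫ g') h').comp
        (((comp₁Comp_overFst f g f' g').whiskerRight _).comp ((Over.associator _ _ _).comp
          (((comp₁Comp_inv_overFst g h g' h').whiskerLeft _).comp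
            (comp₁Comp_inv_overFst f (g ≫ h) f' (g' ≫ h')))))) (by simp))
    ((comp₂_overSnd (α_ f g h).hom (α_ f' g' h').hom).unique
      ((comp₁Comp_overSnd (f ≫ g) h (f' ≫ g') h').comp
        (((comp₁Comp_overSnd f g f' g').whiskerRight _).comp ((Over.associator _ _ _).comp
          (((comp₁Comp_inv_overSnd g h g' h').whiskerLeft _).comp
            (comp₁Comp_inv_overSnd f (g ≫ h) f' (g' ≫ h')))))) (by simp))

theorem comp₂_leftUnitor {S S' : Spn X Y} {T T' : Spn Y Z} (h : S ⟶ S') (k : T ⟶ T') :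
    comp₂ (λ_ h).hom (λ_ k).hom =
      (comp₁Comp (𝟙 S) h (𝟙 T) k).hom ≫ (comp₁Id S T).hom ▷ comp₁ h k ≫ (λ_ (comp₁ h k)).hom :=
  ext_comp
    ((comp₂_overFst (λ_ h).hom (λ_ k).hom).unique ((comp₁Comp_overFst (𝟙 S) h (𝟙 T) k).comp
      (((comp₁Id_overFst S T).whiskerRight _).comp (Over.leftUnitor _))) (by simp))
    ((comp₂_overSnd (λ_ h).hom (λ_ k).hom).unique ((comp₁Comp_overSnd (𝟙 S) h (𝟙 T) k).comp
      (((comp₁Id_overSnd S T).whiskerRight _).comp (Over.leftUnitor _))) (by simp))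

theorem comp₂_rightUnitor {S S' : Spn X Y} {T T' : Spn Y Z} (h : S ⟶ S') (k : T ⟶ T') :
    comp₂ (ρ_ h).hom (ρ_ k).hom =
      (comp₁Comp h (𝟙 S') k (𝟙 T')).hom ≫ comp₁ h k ◁ (comp₁Id S' T').hom ≫
        (ρ_ (comp₁ h k)).hom :=
  ext_comp
    ((comp₂_overFst (ρ_ h).hom (ρ_ k).hom).unique ((comp₁Comp_overFst h (𝟙 S') k (𝟙 T')).comp
      (((comp₁Id_overFst S' T').whiskerLeft _).comp (Over.rightUnitor _))) (by simp))
    ((comp₂_overSnd (ρ_ h).hom (ρ_ k).hom).unique ((comp₁Comp_overSnd h (𝟙 S') k (𝟙 T')).comp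
      (((comp₁Id_overSnd S' T').whiskerLeft _).comp (Over.rightUnitor _))) (by simp))

variable (X Y Z) in
/-- The composition pseudofunctor of the tricategory of spans. -/
def compPseudofunctor : (Spn X Y × Spn Y Z) ⥤ᵖ Spn X Z where
  obj S := comp S.1 S.2
  map f := comp₁ f.1 f.2
  map₂ σ := comp₂ σ.1 σ.2
  map₂_id f := comp₂_id f.1 f.2
  map₂_comp σ τ := comp₂_comp σ.1 σ.2 τ.1 τ.2
  mapId S := comp₁Id S.1 S.2
  mapComp f g := comp₁Comp f.1 g.1 f.2 g.2
  map₂_whisker_left f _ _ σ := comp₂_whiskerLeft f.1 f.2 σ.1 σ.2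
  map₂_whisker_right σ h := comp₂_whiskerRight σ.1 σ.2 h.1 h.2
  map₂_associator f g h := comp₂_associator f.1 g.1 h.1 f.2 g.2 h.2
  map₂_left_unitor f := comp₂_leftUnitor f.1 f.2
  map₂_right_unitor f := comp₂_rightUnitor f.1 f.2

end Spn

end CompositionPseudofunctor

section Tricategory

variable {A : Type u} [Bicategory.{w, v} A]

namespace Spn

/-- The identity span. -/
abbrev idSpan (X : A) : Spn X X := ⟨X, 𝟙 X, 𝟙 X⟩

/-- The span `f_*` of a 1-cell `f`. -/
abbrev lowerStar {X Y : A} (f : X ⟶ Y) : Spn X Y := ⟨X, 𝟙 X, f⟩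

variable [FinitelyComplete A] {X Y Z W : A}

/-- The left unitor. -/
def leftUnitorHom (S : Spn X Y) : comp (idSpan X) S ⟶ S :=
  Hom.mk (bipb (𝟙 X) S.l).snd (bipb (𝟙 X) S.l).iso.symm (Iso.refl _)

/-- The inverse left unitor. -/
def leftUnitorInv (S : Spn X Y) : S ⟶ comp (idSpan X) S :=
  Hom.mk (lift S.l (𝟙 S.apex) (ρ_ S.l ≪≫ (λ_ S.l).symm))
    ((α_ _ _ _).symm ≪≫ whiskerRightIso (liftFst _ _ _) (𝟙 X) ≪≫ ρ_ S.l)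
    ((α_ _ _ _).symm ≪≫ whiskerRightIso (liftSnd _ _ _) S.r ≪≫ λ_ S.r)

/-- The right unitor. -/
def rightUnitorHom (S : Spn X Y) : comp S (idSpan Y) ⟶ S :=
  Hom.mk (bipb S.r (𝟙 Y)).fst (Iso.refl _) (bipb S.r (𝟙 Y)).iso

/-- The inverse right unitor. -/
def rightUnitorInv (S : Spn X Y) : S ⟶ comp S (idSpan Y) :=
  Hom.mk (lift (𝟙 S.apex) S.r (λ_ S.r ≪≫ (ρ_ S.r).symm))
    ((α_ _ _ _).symm ≪≫ whiskerRightIso (liftFst _ _ _) S.l ≪≫ λ_ S.l)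
    ((α_ _ _ _).symm ≪≫ whiskerRightIso (liftSnd _ _ _) (𝟙 Y) ≪≫ ρ_ S.r)

section

variable (S : Spn X Y) (T : Spn Y Z) (U : Spn Z W)

/-- The square inducing the second component of the associator. -/
def assocSq : ((bipb (comp S T).r U.l).fst ≫ (bipb S.r T.l).snd) ≫ T.r ≅
    (bipb (comp S T).r U.l).snd ≫ U.l :=
  α_ _ _ _ ≪≫ (bipb (comp S T).r U.l).iso

/-- The associator. -/
def assocHom : comp (comp S T) U ⟶ comp S (comp T U) :=
  Hom.mk
    (lift ((bipb (comp S T).r U.l).fst ≫ (bipb S.r T.l).fst) (lift _ _ (assocSq S T U))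
      (α_ _ _ _ ≪≫ whiskerLeftIso _ (bipb S.r T.l).iso ≪≫ (α_ _ _ _).symm ≪≫
        (whiskerRightIso (liftFst _ _ (assocSq S T U)) T.l).symm ≪≫ α_ _ _ _))
    ((α_ _ _ _).symm ≪≫ whiskerRightIso (liftFst _ _ _) S.l ≪≫ α_ _ _ _)
    ((α_ _ _ _).symm ≪≫ whiskerRightIso (liftSnd _ _ _) (comp T U).r ≪≫ (α_ _ _ _).symm ≪≫
      whiskerRightIso (liftSnd _ _ (assocSq S T U)) U.r)

/-- The square inducing the first component of the inverse associator. -/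
def assocInvSq : (bipb S.r (comp T U).l).fst ≫ S.r ≅
    ((bipb S.r (comp T U).l).snd ≫ (bipb T.r U.l).fst) ≫ T.l :=
  (bipb S.r (comp T U).l).iso ≪≫ (α_ _ _ _).symm

/-- The inverse associator. -/
def assocInv : comp S (comp T U) ⟶ comp (comp S T) U :=
  Hom.mk
    (lift (lift _ _ (assocInvSq S T U)) ((bipb S.r (comp T U).l).snd ≫ (bipb T.r U.l).snd)
      ((α_ _ _ _).symm ≪≫ whiskerRightIso (liftSnd _ _ (assocInvSq S T U)) T.r ≪≫ α_ _ _ _ ≪≫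
        whiskerLeftIso _ (bipb T.r U.l).iso ≪≫ (α_ _ _ _).symm))
    ((α_ _ _ _).symm ≪≫ whiskerRightIso (liftFst _ _ _) (comp S T).l ≪≫ (α_ _ _ _).symm ≪≫
      whiskerRightIso (liftFst _ _ (assocInvSq S T U)) S.l)
    ((α_ _ _ _).symm ≪≫ whiskerRightIso (liftSnd _ _ _) U.r ≪≫ α_ _ _ _)

end

/-- `G` is a right biadjoint of `F` in the tricategory of spans: there are a unit and a counit
satisfying the triangle identities up to invertible 3-cells. -/
def IsRightBiadjoint (F : Spn X Y) (G : Spn Y X) : Prop :=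
  ∃ (η : idSpan X ⟶ comp F G) (ζ : comp G F ⟶ idSpan Y),
    Nonempty (leftUnitorInv F ≫ comp₁ η (𝟙 F) ≫ assocHom F G F ≫ comp₁ (𝟙 F) ζ ≫
      rightUnitorHom F ≅ 𝟙 F) ∧
    Nonempty (rightUnitorInv G ≫ comp₁ (𝟙 G) η ≫ assocInv G F G ≫ comp₁ ζ (𝟙 G) ≫
      leftUnitorHom G ≅ 𝟙 G)

/-- The pseudofunctor `Spn(K, S) : Spn(K, X) ⥤ᵖ Spn(K, Y)` of composition with `S : X → Y`. -/
def postcompose (K : A) (S : Spn X Y) : Spn K X ⥤ᵖ Spn K Y :=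
  (Prod.sectL (Spn K X) S).toPseudofunctor.comp (compPseudofunctor K X Y)

end Spn

end Tricategory

section GroupoidFibration

variable {E : Type u₁} [Bicategory.{w₁, v₁} E] {B : Type u₂} [Bicategory.{w₂, v₂} B]

/-- The functor from `E(K, Z)` to the pseudopullback of `B(PK, Px)` and
`P : E(K, X) ⥤ B(PK, PX)`. -/
def cartesianComparison (P : E ⥤ᵖ B) {Z X : E} (x : Z ⟶ X) (K : E) :
    (K ⟶ Z) ⥤ Limits.CategoricalPullback (postcomp (P.obj K) (P.map x))
      (P.toPrelaxFunctor.mapFunctor K X) where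
  obj k := ⟨P.map k, k ≫ x, (P.mapComp k x).symm⟩
  map σ := ⟨P.map₂ σ, σ ▷ x, by
    simp only [PrelaxFunctor.mapFunctor, postcomp_map, Iso.symm_hom, P.map₂_whisker_right]
    exact (Iso.inv_hom_id_assoc _ _).symm⟩
  map_id _ := Limits.CategoricalPullback.hom_ext (P.map₂_id _) (id_whiskerRight _ _)
  map_comp _ _ :=
    Limits.CategoricalPullback.hom_ext (P.map₂_comp _ _) (comp_whiskerRight _ _ _)

/-- A pseudofunctor between bicategories is a groupoid fibration. -/
structure IsGroupoidFibration (P : E ⥤ᵖ B) : Prop where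
  exists_lift : ∀ (X : E) {b : B} (f : b ⟶ P.obj X), ∃ (Z : E) (x : Z ⟶ X) (e : b ⟶ P.obj Z),
    IsEquiv e ∧ Nonempty (e ≫ P.map x ≅ f)
  /-- Every morphism is cartesian. -/
  cartesian : ∀ {Z X : E} (x : Z ⟶ X) (K : E), (cartesianComparison P x K).IsEquivalence
  /-- Every 2-cell is cartesian. -/
  cartesian₂ : ∀ {Z X : E} {x' x : Z ⟶ X} (σ : x' ⟶ x),
    (P.toPrelaxFunctor.mapFunctor Z X).IsStronglyCartesian (P.map₂ σ) σ

end GroupoidFibration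

/-- A span is a groupoid fibration in the tricategory of spans. -/
def Spn.IsGroupoidFibration {A : Type u} [Bicategory.{w, v} A] [FinitelyComplete A] {X Y : A}
    (S : Spn X Y) : Prop :=
  ∀ K : A, BicatSpan.IsGroupoidFibration (S.postcompose K)

end BicatSpan

end

noncomputable section

namespace BicatSpan

/-! ### Calculus of equivalences in a bicategory, and their triangle identities. -/

section Equivalences

variable {A : Type u} [Bicategory.{w, v} A] {X Y S : A}

/-! Every condition is compared with the invertibility of the left leg, and the arguments work by
projecting 1-cells and 2-cells out of bipullbacks.

From (iii) to (ii): the left leg of `f_*` is an identity, so the left triangle of an equivalence `S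
≌ f_*` identifies its underlying 1-cell with `S.l`. Conversely, transporting `S` along an inverse of
`S.l` gives `f_*` with `f` the inverse followed by `S.r`.

From (i) to (ii): following the first triangle identity through first projections leaves `F.l ≫
η.map ≫ fst ≅ 𝟙`, while the left triangle of the unit `η` says that `η.map ≫ fst` is also inverse to
`F.l` on the other side (`IsRightBiadjoint.isEquiv`). Conversely, if `F.l` is an equivalence, the
reversed span is a right biadjoint: the unit pairs an inverse of `F.l` with itself, and the counit
exists because the two projections of the bipullback of `F.l` with itself are isomorphic
(`isRightBiadjoint_reverse`).

From (iv) to (ii): cartesianness is applied to one morphism only, `S.l` seen as a morphism from the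
span `(S.l, S.l)` to the identity span. After composition with `S` it acquires a section, the
diagonal; cartesianness lifts this to a section of `S.l` itself, and comparing the lift with the
diagonal shows that it is a two-sided inverse (`IsGroupoidFibration.isEquiv`).

From (ii) to (iv): the projection `W.apex ×_X S.apex → W.apex` is a bipullback of `S.l`, hence an
equivalence. So 1-cells and 2-cells between composites with `S` descend to the apices, together with
their compatibility with left legs. Compatibility with right legs into `X` does not descend, since a
composite with `S` remembers only legs into `Y`; this is why a fibration is obtained rather than a
local equivalence. In each fibration axiom the missing right-leg condition is supplied by the
morphism or 2-cell along which one lifts. -/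

theorem IsEquiv.postcomp_isEquivalence {f : X ⟶ Y} (hf : IsEquiv f) (K : A) :
    (postcomp K f).IsEquivalence := by
  obtain ⟨g, ⟨e⟩, ⟨e'⟩⟩ := hf
  have h₁ {s t : K ⟶ X} (σ : s ⟶ t) : σ ≫ (ρ_ t).inv ≫ t ◁ e.inv ≫ (α_ t f g).inv =
      ((ρ_ s).inv ≫ s ◁ e.inv ≫ (α_ s f g).inv) ≫ σ ▷ f ▷ g := by
    rw [rightUnitor_inv_naturality_assoc, ← whisker_exchange_assoc]; simp
  have h₂ {s t : K ⟶ Y} (σ : s ⟶ t) : σ ▷ g ▷ f ≫ (α_ t g f).hom ≫ t ◁ e'.hom ≫ (ρ_ t).hom =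
      ((α_ s g f).hom ≫ s ◁ e'.hom ≫ (ρ_ s).hom) ≫ σ := by
    simp only [Category.assoc, ← rightUnitor_naturality]
    rw [whisker_exchange_assoc]; simp
  exact (CategoryTheory.Equivalence.mk (postcomp K f) (postcomp K g)
    (NatIso.ofComponents (fun t => (ρ_ t).symm ≪≫ whiskerLeftIso t e.symm ≪≫ (α_ t f g).symm) h₁)
    (NatIso.ofComponents (fun t => α_ t g f ≪≫ whiskerLeftIso t e' ≪≫ ρ_ t)
      h₂)).isEquivalence_functor

theorem IsEquiv.precomp_isEquivalence {f : X ⟶ Y} (hf : IsEquiv f) (K : A) :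
    (precomp K f).IsEquivalence := by
  obtain ⟨g, ⟨e⟩, ⟨e'⟩⟩ := hf
  have h₁ {s t : Y ⟶ K} (σ : s ⟶ t) : σ ≫ (λ_ t).inv ≫ e'.inv ▷ t ≫ (α_ g f t).hom =
      ((λ_ s).inv ≫ e'.inv ▷ s ≫ (α_ g f s).hom) ≫ g ◁ f ◁ σ := by
    rw [leftUnitor_inv_naturality_assoc, whisker_exchange_assoc]; simp
  have h₂ {s t : X ⟶ K} (σ : s ⟶ t) : f ◁ g ◁ σ ≫ (α_ f g t).inv ≫ e.hom ▷ t ≫ (λ_ t).hom =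
      ((α_ f g s).inv ≫ e.hom ▷ s ≫ (λ_ s).hom) ≫ σ := by
    simp only [Category.assoc, ← leftUnitor_naturality]
    rw [← whisker_exchange_assoc]; simp
  exact (CategoryTheory.Equivalence.mk (precomp K f) (precomp K g)
    (NatIso.ofComponents (fun t => (λ_ t).symm ≪≫ whiskerRightIso e'.symm t ≪≫ α_ g f t) h₁)
    (NatIso.ofComponents (fun t => (α_ f g t).symm ≪≫ whiskerRightIso e t ≪≫ λ_ t)
      h₂)).isEquivalence_functor

/-- The 2-cell `σ` with `σ ▷ f = κ`. -/
def IsEquiv.unwhiskerRight {f : X ⟶ Y} (hf : IsEquiv f) {K : A} {s t : K ⟶ X}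
    (κ : s ≫ f ⟶ t ≫ f) : s ⟶ t :=
  haveI := hf.postcomp_isEquivalence K
  (postcomp K f).preimage κ

@[simp]
theorem IsEquiv.unwhiskerRight_whiskerRight {f : X ⟶ Y} (hf : IsEquiv f) {K : A} {s t : K ⟶ X}
    (κ : s ≫ f ⟶ t ≫ f) : hf.unwhiskerRight κ ▷ f = κ :=
  haveI := hf.postcomp_isEquivalence K
  (postcomp K f).map_preimage κ

theorem IsEquiv.whiskerRight_injective {f : X ⟶ Y} (hf : IsEquiv f) {K : A} {s t : K ⟶ X}
    {σ τ : s ⟶ t} (h : σ ▷ f = τ ▷ f) : σ = τ :=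
  haveI := hf.postcomp_isEquivalence K
  (postcomp K f).map_injective h

/-- The invertible 2-cell `σ` with `σ ▷ f = κ`. -/
@[simps]
def IsEquiv.unwhiskerRightIso {f : X ⟶ Y} (hf : IsEquiv f) {K : A} {s t : K ⟶ X}
    (κ : s ≫ f ≅ t ≫ f) : s ≅ t where
  hom := hf.unwhiskerRight κ.hom
  inv := hf.unwhiskerRight κ.inv
  hom_inv_id := hf.whiskerRight_injective (by simp)
  inv_hom_id := hf.whiskerRight_injective (by simp)

/-- The 2-cell `σ` with `f ◁ σ = κ`. -/
def IsEquiv.unwhiskerLeft {f : X ⟶ Y} (hf : IsEquiv f) {K : A} {s t : Y ⟶ K}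
    (κ : f ≫ s ⟶ f ≫ t) : s ⟶ t :=
  haveI := hf.precomp_isEquivalence K
  (precomp K f).preimage κ

@[simp]
theorem IsEquiv.whiskerLeft_unwhiskerLeft {f : X ⟶ Y} (hf : IsEquiv f) {K : A} {s t : Y ⟶ K}
    (κ : f ≫ s ⟶ f ≫ t) : f ◁ hf.unwhiskerLeft κ = κ :=
  haveI := hf.precomp_isEquivalence K
  (precomp K f).map_preimage κ

theorem IsEquiv.whiskerLeft_injective {f : X ⟶ Y} (hf : IsEquiv f) {K : A} {s t : Y ⟶ K}
    {σ τ : s ⟶ t} (h : f ◁ σ = f ◁ τ) : σ = τ :=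
  haveI := hf.precomp_isEquivalence K
  (precomp K f).map_injective h

/-- The invertible 2-cell `σ` with `f ◁ σ = κ`. -/
@[simps]
def IsEquiv.unwhiskerLeftIso {f : X ⟶ Y} (hf : IsEquiv f) {K : A} {s t : Y ⟶ K}
    (κ : f ≫ s ≅ f ≫ t) : s ≅ t where
  hom := hf.unwhiskerLeft κ.hom
  inv := hf.unwhiskerLeft κ.inv
  hom_inv_id := hf.whiskerLeft_injective (by simp)
  inv_hom_id := hf.whiskerLeft_injective (by simp)

/-- An inverse of an equivalence. -/
def IsEquiv.inverse {f : X ⟶ Y} (hf : IsEquiv f) : Y ⟶ X := hf.choose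

/-- The counit of an equivalence. -/
def IsEquiv.counit {f : X ⟶ Y} (hf : IsEquiv f) : hf.inverse ≫ f ≅ 𝟙 Y :=
  hf.choose_spec.2.some

/-- The inverse of the unit of an equivalence. -/
def IsEquiv.unit {f : X ⟶ Y} (hf : IsEquiv f) : f ≫ hf.inverse ≅ 𝟙 X :=
  hf.unwhiskerRightIso (α_ _ _ _ ≪≫ whiskerLeftIso f hf.counit ≪≫ ρ_ f ≪≫ (λ_ f).symm)

-- The isomorphism stored in `IsEquiv` need not satisfy a triangle identity. `unit` is instead
-- defined by solving this identity for the given counit, which is possible because whiskering with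
-- `f` is fully faithful.
@[simp]
theorem IsEquiv.unit_whiskerRight {f : X ⟶ Y} (hf : IsEquiv f) :
    hf.unit.hom ▷ f = (α_ _ _ _).hom ≫ f ◁ hf.counit.hom ≫ (ρ_ f).hom ≫ (λ_ f).inv := by
  simp [IsEquiv.unit]

/-- The second triangle identity follows from the first: it may be tested after whiskering with `f`.
-/
theorem IsEquiv.whiskerLeft_unit {f : X ⟶ Y} (hf : IsEquiv f) :
    hf.inverse ◁ hf.unit.hom = (α_ _ _ _).inv ≫ hf.counit.hom ▷ hf.inverse ≫
      (λ_ _).hom ≫ (ρ_ _).inv := by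
  apply hf.whiskerRight_injective
  -- For an invertible `θ : t ⟶ 𝟙`, the cells `t ◁ θ` and `θ ▷ t` agree up to unitors: after
  -- composition with `θ` this is the interchange law.
  have h : (hf.inverse ≫ f) ◁ hf.counit.hom ≫ (ρ_ _).hom =
      hf.counit.hom ▷ (hf.inverse ≫ f) ≫ (λ_ _).hom := by
    rw [← cancel_mono hf.counit.hom]
    simp only [Category.assoc, ← rightUnitor_naturality, ← leftUnitor_naturality]
    rw [whisker_exchange_assoc, unitors_equal]
  have h' : hf.inverse ◁ f ◁ hf.counit.hom = (α_ _ _ _).inv ≫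
      ((hf.inverse ≫ f) ◁ hf.counit.hom ≫ (ρ_ _).hom) ≫ (ρ_ _).inv ≫ (α_ _ _ _).hom := by simp
  simp only [whisker_assoc, unit_whiskerRight, whiskerLeft_comp, Category.assoc, h', h,
    comp_whiskerRight]
  bicategory

end Equivalences

/-! ### Spans equivalent to some `f_*`. -/

section LowerStar

variable {A : Type u} [Bicategory.{w, v} A] {X Y : A}

namespace Spn

/-- The left leg of `f_*` is an identity, so `E.hom.lam` makes `E.hom.map` isomorphic to `S.l`. -/
theorem isEquiv_of_equivalence_lowerStar {S : Spn X Y} {f : X ⟶ Y} (E : S ≌ lowerStar f) :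
    IsEquiv S.l :=
  have e : E.hom.map ≅ S.l := (ρ_ _).symm ≪≫ E.hom.lam
  ⟨E.inv.map, ⟨whiskerRightIso e.symm _ ≪≫ (cellIso E.unit).symm⟩,
    ⟨whiskerLeftIso _ e.symm ≪≫ cellIso E.counit⟩⟩

/-- The 1-cells `S.l` and `hS.inverse` underlie the two morphisms of spans, and the adjoint
equivalence provides their unit and counit. -/
theorem exists_equivalence_lowerStar {S : Spn X Y} (hS : IsEquiv S.l) :
    ∃ f : X ⟶ Y, Nonempty (S ≌ lowerStar f) := by
  refine ⟨hS.inverse ≫ S.r, ⟨?_⟩⟩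
  let h : S ⟶ lowerStar (hS.inverse ≫ S.r) := Hom.mk S.l (ρ_ _)
    ((α_ _ _ _).symm ≪≫ whiskerRightIso hS.unit S.r ≪≫ λ_ _)
  let k : lowerStar (hS.inverse ≫ S.r) ⟶ S := Hom.mk hS.inverse hS.counit (Iso.refl _)
  refine Bicategory.Equivalence.mkOfAdjointifyCounit (f := h) (g := k)
    (mkIso (h ≫ k) (𝟙 S) hS.unit ?_ ?_).symm (mkIso (k ≫ h) (𝟙 _) hS.counit ?_ ?_)
  · simp [h, k]
  · simp [h, k]
  · simp [h, k]
  -- The counit respects the right legs by the second triangle identity, whiskered with `S.r`.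
  · have := congrArg (fun z => (α_ _ _ _).hom ≫ hS.inverse ◁ (α_ _ _ _).inv ≫ (α_ _ _ _).inv ≫
      z ▷ S.r ≫ (α_ _ _ _).hom ≫ hS.inverse ◁ (λ_ S.r).hom) hS.whiskerLeft_unit
    simp only [whisker_assoc, comp_whiskerRight, Category.assoc, Iso.inv_hom_id_assoc] at this
    simp only [h, k, comp_rho_hom, Iso.trans_hom, Iso.symm_hom, whiskerRightIso_hom,
      whiskerLeft_comp, Category.assoc, Iso.refl_hom, id_rho_hom, comp_map, id_map,
      whiskerRight_comp]
    refine Eq.trans ?_ (this.symm.trans (by simp))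
    bicategory

end Spn

end LowerStar

/-! ### A right biadjoint forces the left leg to be an equivalence. -/

section Biadjoint

variable {A : Type u} [Bicategory.{w, v} A] [FinitelyComplete A] {X Y Z W : A}

namespace Spn

/-- Only the first triangle is needed. Each factor commutes with first projections: `e₁` to `e₄`
treat the inverse unitor, the unit, the associator and the counit, and the last unitor is itself a
first projection. -/
theorem IsRightBiadjoint.isEquiv {F : Spn X Y} {G : Spn Y X} (h : IsRightBiadjoint F G) :
    IsEquiv F.l := by
  obtain ⟨η, ζ, ⟨e⟩, -⟩ := h
  have e₄ : (comp₁ (𝟙 F) ζ).map ≫ (bipb F.r (𝟙 Y)).fst ≅ (bipb F.r (comp G F).l).fst :=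
    comp₁Fst (𝟙 F) ζ ≪≫ ρ_ _
  have e₃ : (assocHom F G F).map ≫ (bipb F.r (comp G F).l).fst ≅
      (bipb (comp F G).r F.l).fst ≫ (bipb F.r G.l).fst := liftFst _ _ _
  have e₂ : (comp₁ η (𝟙 F)).map ≫ (bipb (comp F G).r F.l).fst ≅ (bipb (𝟙 X) F.l).fst ≫ η.map :=
    comp₁Fst η (𝟙 F)
  have e₁ : (leftUnitorInv F).map ≫ (bipb (𝟙 X) F.l).fst ≅ F.l := liftFst _ _ _
  have e₀ : (leftUnitorInv F).map ≫ (comp₁ η (𝟙 F)).map ≫ (assocHom F G F).map ≫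
      (comp₁ (𝟙 F) ζ).map ≫ (bipb F.r (𝟙 Y)).fst ≅ 𝟙 F.apex := cellIso e
  exact ⟨η.map ≫ (bipb F.r G.l).fst,
    ⟨(α_ _ _ _).symm ≪≫ whiskerRightIso (whiskerRightIso e₁.symm _ ≪≫ α_ _ _ _) _ ≪≫
      α_ _ _ _ ≪≫ whiskerLeftIso _ (whiskerRightIso e₂.symm _ ≪≫ α_ _ _ _ ≪≫
      whiskerLeftIso _ (e₃.symm ≪≫ whiskerLeftIso _ e₄.symm)) ≪≫ e₀⟩, ⟨α_ _ _ _ ≪≫ η.lam⟩⟩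

end Spn

end Biadjoint

/-! ### Morphisms into a composite span, described by components. -/

section Representation

variable {A : Type u} [Bicategory.{w, v} A] [FinitelyComplete A] {X Y Z : A}

namespace Spn

variable {R R' : Spn X Z} {S : Spn X Y} {T : Spn Y Z}

/-- A presentation of a morphism into a composite of spans by its components. -/
structure Rep (f : R ⟶ comp S T) (a : R.apex ⟶ S.apex) (b : R.apex ⟶ T.apex)
    (φ : a ≫ S.r ≅ b ≫ T.l) (lam : a ≫ S.l ≅ R.l) (rho : b ≫ T.r ≅ R.r) where
  pres : Pres f.map a b φ
  lam_eq : f.lam.hom = (α_ _ _ _).inv ≫ pres.e.hom ▷ S.l ≫ lam.hom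
  rho_eq : f.rho.hom = (α_ _ _ _).inv ≫ pres.f.hom ▷ T.r ≫ rho.hom

/-- The morphism into a composite of spans with given components. -/
def pair (a : R.apex ⟶ S.apex) (b : R.apex ⟶ T.apex)
    (φ : a ≫ S.r ≅ b ≫ T.l) (lam : a ≫ S.l ≅ R.l) (rho : b ≫ T.r ≅ R.r) : R ⟶ comp S T :=
  Hom.mk (lift a b φ) ((α_ _ _ _).symm ≪≫ whiskerRightIso (liftFst a b φ) S.l ≪≫ lam)
    ((α_ _ _ _).symm ≪≫ whiskerRightIso (liftSnd a b φ) T.r ≪≫ rho)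

/-- The presentation of `pair`. -/
def pairRep (a : R.apex ⟶ S.apex) (b : R.apex ⟶ T.apex)
    (φ : a ≫ S.r ≅ b ≫ T.l) (lam : a ≫ S.l ≅ R.l) (rho : b ≫ T.r ≅ R.r) :
    Rep (pair a b φ lam rho) a b φ lam rho where
  pres := liftPres a b φ
  lam_eq := rfl
  rho_eq := rfl

section

variable {f : R ⟶ comp S T} {a : R.apex ⟶ S.apex} {b : R.apex ⟶ T.apex} {φ : a ≫ S.r ≅ b ≫ T.l}
  {lam : a ≫ S.l ≅ R.l} {rho : b ≫ T.r ≅ R.r}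

/-- Transport of a presentation along isomorphisms of the components. -/
def Rep.trans (H : Rep f a b φ lam rho) {a' : R.apex ⟶ S.apex} {b' : R.apex ⟶ T.apex}
    {φ' : a' ≫ S.r ≅ b' ≫ T.l} {lam' : a' ≫ S.l ≅ R.l} {rho' : b' ≫ T.r ≅ R.r}
    (α : a ≅ a') (β : b ≅ b') (h : α.hom ▷ S.r ≫ φ'.hom = φ.hom ≫ β.hom ▷ T.l)
    (hl : α.hom ▷ S.l ≫ lam'.hom = lam.hom) (hr : β.hom ▷ T.r ≫ rho'.hom = rho.hom) :
    Rep f a' b' φ' lam' rho' where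
  pres := H.pres.trans α β h
  lam_eq := by simp [H.lam_eq, hl]
  rho_eq := by simp [H.rho_eq, hr]

/-- Precomposition of a presentation with a morphism. -/
def Rep.precomp (H : Rep f a b φ lam rho) (g : R' ⟶ R) :
    Rep (g ≫ f) (g.map ≫ a) (g.map ≫ b) (whiskerSq g.map φ)
      (α_ _ _ _ ≪≫ whiskerLeftIso g.map lam ≪≫ g.lam)
      (α_ _ _ _ ≪≫ whiskerLeftIso g.map rho ≪≫ g.rho) where
  pres := H.pres.whisker g.map
  lam_eq := by simp [H.lam_eq]
  rho_eq := by simp [H.rho_eq]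

/-- Morphisms with the same presentation are isomorphic. -/
def Rep.iso (H : Rep f a b φ lam rho) {f' : R ⟶ comp S T} (H' : Rep f' a b φ lam rho) : f ≅ f' :=
  mkIso f f' (H.pres.iso H'.pres (Iso.refl _) (Iso.refl _) (by simp))
    (by rw [H.lam_eq, H'.lam_eq]; exact leg_aux (Pres.iso_hom_fst_e _ _ _ _ _) (id_aux _))
    (by rw [H.rho_eq, H'.rho_eq]; exact leg_aux (Pres.iso_hom_snd_f _ _ _ _ _) (id_aux _))

end

/-- The presentation of a horizontal composite. -/
def comp₁Rep {S' : Spn X Y} {T' : Spn Y Z} (h : S ⟶ S') (k : T ⟶ T') :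
    Rep (comp₁ h k) ((bipb S.r T.l).fst ≫ h.map) ((bipb S.r T.l).snd ≫ k.map) (compSq h k)
      (α_ _ _ _ ≪≫ whiskerLeftIso _ h.lam) (α_ _ _ _ ≪≫ whiskerLeftIso _ k.rho) where
  pres := liftPres _ _ (compSq h k)
  lam_eq := rfl
  rho_eq := rfl

end Spn

end Representation

/-! ### A groupoid fibration has an equivalence as left leg. -/

section

variable {A : Type u} [Bicategory.{w, v} A] [FinitelyComplete A] {X Y : A}

namespace Spn

/-- The span with both legs equal to the left leg of `S`. -/
abbrev legSpan (S : Spn X Y) : Spn X X := ⟨S.apex, S.l, S.l⟩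

/-- The left leg of `S` as a morphism of spans. -/
abbrev legHom (S : Spn X Y) : legSpan S ⟶ idSpan X := Hom.mk S.l (ρ_ _) (ρ_ _)

/-- The diagonal of the left leg of `S`. -/
def diagonal (S : Spn X Y) : comp (idSpan X) S ⟶ comp (legSpan S) S :=
  pair (bipb (𝟙 X) S.l).snd (bipb (𝟙 X) S.l).snd (Iso.refl _) (bipb (𝟙 X) S.l).iso.symm
    (Iso.refl _)

/-- The presentation of the diagonal. -/
def diagonalRep (S : Spn X Y) : Rep (diagonal S) (bipb (𝟙 X) S.l).snd (bipb (𝟙 X) S.l).snd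
    (Iso.refl _) (bipb (𝟙 X) S.l).iso.symm (Iso.refl _) :=
  pairRep _ _ _ _ _

/-- The diagonal is a section of the image of the left leg. -/
def diagonalIso (S : Spn X Y) :
    diagonal S ≫ comp₁ (legHom S) (𝟙 S) ≅ comp₁ (𝟙 (idSpan X)) (𝟙 S) := by
  -- Both sides are brought to the same components, `snd ≫ S.l` and `snd`. On the right-hand side
  -- the first component starts as `fst ≫ 𝟙 X`, and the bipullback cell itself is the comparison.
  refine Rep.iso (a := (bipb (𝟙 X) S.l).snd ≫ S.l) (b := (bipb (𝟙 X) S.l).snd) (φ := ρ_ _)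
    (lam := ρ_ _ ≪≫ (bipb (𝟙 X) S.l).iso.symm) (rho := Iso.refl _)
    (((comp₁Rep _ _).precomp _).trans
      ((α_ _ _ _).symm ≪≫ whiskerRightIso (diagonalRep S).pres.e _)
      (whiskerLeftIso _ (ρ_ _) ≪≫ (diagonalRep S).pres.f) ?_ ?_ ?_)
    ((comp₁Rep _ _).trans (bipb (𝟙 X) S.l).iso (ρ_ _) ?_ ?_ ?_)
  · have := (diagonalRep S).pres.w
    simp only [Square.cell_hom, Iso.refl_hom, Category.comp_id] at this
    simp [compSq_hom, this]
    bicategory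
  · simp [(diagonalRep S).lam_eq]
  · simp [(diagonalRep S).rho_eq]
    bicategory
  · simp [compSq_hom]
  · simp
  · simp

/-- The diagonal and the identity of `idSpan X` form an object of the pseudopullback, so essential
surjectivity of the comparison yields `k : idSpan X ⟶ legSpan S` inducing the diagonal. Its left
triangle gives `k.map ≫ S.l ≅ 𝟙`. -/
theorem IsGroupoidFibration.isEquiv {S : Spn X Y} (h : S.IsGroupoidFibration) :
    IsEquiv S.l := by
  have := (h X).cartesian (legHom S) (idSpan X)
  let d : Limits.CategoricalPullback
      (postcomp ((S.postcompose X).obj (idSpan X)) ((S.postcompose X).map (legHom S)))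
      ((S.postcompose X).toPrelaxFunctor.mapFunctor (idSpan X) (idSpan X)) :=
    ⟨diagonal S, 𝟙 (idSpan X), diagonalIso S⟩
  let P := cartesianComparison (S.postcompose X) (legHom S) (idSpan X)
  let k : idSpan X ⟶ legSpan S := P.objPreimage d
  let κ : comp₁ k (𝟙 S) ≅ diagonal S :=
    (Limits.CategoricalPullback.π₁ _ _).mapIso (P.objObjPreimageIso d)
  -- First components of `κ`; restricted along the inverse unitor, whose components are `S.l` and
  -- `𝟙`, this becomes `S.l ≫ k.map ≅ 𝟙`.
  have κ₁ : (bipb (𝟙 X) S.l).fst ≫ k.map ≅ (bipb (𝟙 X) S.l).snd :=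
    (comp₁Fst k (𝟙 S)).symm ≪≫ whiskerRightIso (cellIso κ) _ ≪≫ liftFst _ _ _
  have e₁ : (leftUnitorInv S).map ≫ (bipb (𝟙 X) S.l).fst ≅ S.l := liftFst _ _ _
  have e₂ : (leftUnitorInv S).map ≫ (bipb (𝟙 X) S.l).snd ≅ 𝟙 _ := liftSnd _ _ _
  exact ⟨k.map, ⟨whiskerRightIso e₁.symm _ ≪≫ α_ _ _ _ ≪≫ whiskerLeftIso _ κ₁ ≪≫ e₂⟩, ⟨k.lam⟩⟩

end Spn

end

/-! ### Bipullbacks along an equivalence. -/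

section Pullback

variable {A : Type u} [Bicategory.{w, v} A] [FinitelyComplete A] {X Y C K : A}

/-- The bipullback cell determines the second component whiskered with `p` from the first component,
and whiskering with `p` is faithful. -/
theorem IsEquiv.ext_fst {n : X ⟶ C} {p : Y ⟶ C} (hp : IsEquiv p) {s t : K ⟶ (bipb n p).pt}
    {σ τ : s ⟶ t} (h : σ ▷ (bipb n p).fst = τ ▷ (bipb n p).fst) : σ = τ := by
  refine lift₂_ext h (hp.whiskerRight_injective ?_)
  have h₁ := (bipb n p).cell_naturality σ
  rw [h, (bipb n p).cell_naturality τ, cancel_epi] at h₁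
  exact h₁.symm

/-- An invertible 2-cell into a bipullback along an equivalence is determined by its first
component. -/
def IsEquiv.isoOfFst {n : X ⟶ C} {p : Y ⟶ C} (hp : IsEquiv p) {s t : K ⟶ (bipb n p).pt}
    (e : s ≫ (bipb n p).fst ≅ t ≫ (bipb n p).fst) : s ≅ t :=
  lift₂Iso e (hp.unwhiskerRightIso
    (((bipb n p).cell s).symm ≪≫ whiskerRightIso e n ≪≫ (bipb n p).cell t)) (by simp [Compat])

@[simp]
theorem IsEquiv.isoOfFst_hom_fst {n : X ⟶ C} {p : Y ⟶ C} (hp : IsEquiv p)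
    {s t : K ⟶ (bipb n p).pt} (e : s ≫ (bipb n p).fst ≅ t ≫ (bipb n p).fst) :
    (hp.isoOfFst e).hom ▷ (bipb n p).fst = e.hom := by simp [IsEquiv.isoOfFst]

/-- The bipullback of an equivalence is an equivalence. -/
theorem IsEquiv.bipb_fst {n : X ⟶ C} {p : Y ⟶ C} (hp : IsEquiv p) : IsEquiv (bipb n p).fst := by
  let φ : 𝟙 X ≫ n ≅ (n ≫ hp.inverse) ≫ p :=
    λ_ n ≪≫ (ρ_ n).symm ≪≫ whiskerLeftIso n hp.counit.symm ≪≫ (α_ _ _ _).symm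
  exact ⟨lift (𝟙 X) (n ≫ hp.inverse) φ,
    ⟨hp.isoOfFst (α_ _ _ _ ≪≫ whiskerLeftIso _ (liftFst _ _ φ) ≪≫ ρ_ _ ≪≫ (λ_ _).symm)⟩,
    ⟨liftFst _ _ φ⟩⟩

end Pullback

/-! ### Transferring compatibility with the legs. -/

section Legs

variable {A : Type u} [Bicategory.{w, v} A]

/-- Transfers a leg condition between composites with `S` and the apices below them. It is read
forwards to descend 2-cells along the projection, and backwards to check that a constructed 2-cell
is one of spans. -/
theorem Over.leg_iff {P P' V V' Z : A} {d : P ⟶ V} {d' : P' ⟶ V'} {t t' : P ⟶ P'} {a a' : V ⟶ V'}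
    {e : t ≫ d' ≅ d ≫ a} {e' : t' ≫ d' ⟶ d ≫ a'} {Θ : t ⟶ t'} {β : a ⟶ a'}
    (H : Over e.hom e' Θ β) {l : V' ⟶ Z} {q : V ⟶ Z} (f : a ≫ l ⟶ q) (f' : a' ≫ l ⟶ q) :
    (Θ ▷ (d' ≫ l) ≫ (α_ _ _ _).inv ≫ e' ▷ l ≫ (α_ _ _ _).hom ≫ d ◁ f' =
      (α_ _ _ _).inv ≫ e.hom ▷ l ≫ (α_ _ _ _).hom ≫ d ◁ f) ↔ d ◁ (β ▷ l ≫ f') = d ◁ f := by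
  have h₁ := congrArg (fun z => z ▷ l) H
  simp only [comp_whiskerRight] at h₁
  rw [whiskerRight_comp_assoc, Iso.hom_inv_id_assoc, reassoc_of% h₁, cancel_epi,
    cancel_epi (e.hom ▷ l), whisker_assoc]
  simp

theorem IsEquiv.unit_leg {S T X : A} {f : S ⟶ T} (hf : IsEquiv f) {l : T ⟶ X} {l' : S ⟶ X}
    (m : f ≫ l ≅ l') : hf.unit.hom ▷ l' ≫ (λ_ l').hom =
      (α_ _ _ _).hom ≫ f ◁ (hf.inverse ◁ m.inv ≫ (α_ _ _ _).inv ≫ hf.counit.hom ▷ l ≫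
        (λ_ l).hom) ≫ m.hom := by
  rw [← cancel_epi ((f ≫ hf.inverse) ◁ m.hom), whisker_exchange_assoc]
  simp [hf.unit_whiskerRight]

theorem retraction_whiskerRight {P B C D : A} {e : B ⟶ P} {d : P ⟶ B} (θ : e ≫ d ⟶ 𝟙 B)
    (q : B ⟶ C) (r : C ⟶ D) :
    ((α_ e d q).inv ≫ θ ▷ q ≫ (λ_ q).hom) ▷ r =
      (α_ _ _ _).hom ≫ e ◁ (α_ _ _ _).hom ≫ (α_ _ _ _).inv ≫ θ ▷ (q ≫ r) ≫ (λ_ _).hom := by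
  simp

theorem retraction_leg {P B C D : A} {e : B ⟶ P} {d : P ⟶ B} (θ : e ≫ d ⟶ 𝟙 B)
    {q : B ⟶ C} {r : C ⟶ D} {s : B ⟶ D} (g : q ≫ r ⟶ s) :
    ((α_ e d q).inv ≫ θ ▷ q ≫ (λ_ q).hom) ▷ r ≫ g =
      (α_ _ _ _).hom ≫ e ◁ ((α_ _ _ _).hom ≫ d ◁ g) ≫ (α_ _ _ _).inv ≫ θ ▷ s ≫ (λ_ s).hom := by
  have h : (α_ _ _ _).inv ≫ θ ▷ (q ≫ r) ≫ (λ_ _).hom ≫ g =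
      e ◁ d ◁ g ≫ (α_ _ _ _).inv ≫ θ ▷ s ≫ (λ_ s).hom := by
    rw [← leftUnitor_naturality, ← whisker_exchange_assoc]; simp
  rw [retraction_whiskerRight]
  simp only [Category.assoc, h, whiskerLeft_comp]

variable {X Y : A}

namespace Spn

/-- By interchange, the condition for the composites is the condition for `f` and `g` preceded by
`f.map ◁ x.rho.hom`, which is invertible. -/
theorem rho_of_comp_rho {R S T : Spn X Y} {f g : R ⟶ S} (x : S ⟶ T) (χ : f.map ⟶ g.map)
    (h : (χ ▷ x.map) ▷ T.r ≫ (g ≫ x).rho.hom = (f ≫ x).rho.hom) :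
    χ ▷ S.r ≫ g.rho.hom = f.rho.hom := by
  have h₁ : χ ▷ x.map ▷ T.r ≫ (α_ g.map x.map T.r).hom ≫ g.map ◁ x.rho.hom =
      (α_ f.map x.map T.r).hom ≫ f.map ◁ x.rho.hom ≫ χ ▷ S.r := by
    rw [whisker_exchange]; simp
  simp only [comp_rho_hom] at h
  rw [reassoc_of% h₁, cancel_epi, cancel_epi] at h
  exact h

/-- The legs of the inverse are obtained through the counit; the unit then respects them by the
triangle identity, in the form `IsEquiv.unit_leg`. -/
theorem isEquiv_of_isEquiv_map {S T : Spn X Y} {f : S ⟶ T} (hf : IsEquiv f.map) : IsEquiv f := by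
  let g : T ⟶ S := Hom.mk hf.inverse
    (whiskerLeftIso _ f.lam.symm ≪≫ (α_ _ _ _).symm ≪≫ whiskerRightIso hf.counit _ ≪≫ λ_ _)
    (whiskerLeftIso _ f.rho.symm ≪≫ (α_ _ _ _).symm ≪≫ whiskerRightIso hf.counit _ ≪≫ λ_ _)
  exact ⟨g, ⟨mkIso (f ≫ g) (𝟙 S) hf.unit (hf.unit_leg f.lam) (hf.unit_leg f.rho)⟩,
    ⟨mkIso (g ≫ f) (𝟙 T) hf.counit (by simp [g]) (by simp [g])⟩⟩

end Spn

end Legs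

/-! ### A span whose left leg is an equivalence is a groupoid fibration. -/

section Fibration

variable {A : Type u} [Bicategory.{w, v} A] [FinitelyComplete A] {X Y K : A}

namespace Spn

variable (S : Spn X Y)

/-- The composition constraint of `S.postcompose K`. -/
def postcomposeMapComp {W Z T : Spn K X} (k : W ⟶ Z) (x : Z ⟶ T) :
    comp₁ (k ≫ x) (𝟙 S) ≅ comp₁ k (𝟙 S) ≫ comp₁ x (𝟙 S) :=
  (S.postcompose K).mapComp k x

/-- The constraint differs from `comp₁Comp` by a unitor in the variable `S`, which is invisible on
first components. -/
theorem postcomposeMapComp_overFst {W Z T : Spn K X} (k : W ⟶ Z) (x : Z ⟶ T) :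
    Over (comp₁Fst (k ≫ x) (𝟙 S)).hom (paste (comp₁Fst k (𝟙 S)).hom (comp₁Fst x (𝟙 S)).hom)
      (cell (postcomposeMapComp S k x).hom) (𝟙 (k.map ≫ x.map)) := by
  have h := (comp₂_overFst (𝟙 (k ≫ x)) (λ_ (𝟙 S)).inv).comp (comp₁Comp_overFst k x (𝟙 S) (𝟙 S))
  rw [cell_id, Category.id_comp] at h
  exact h

theorem postcomposeMapComp_inv_overFst {W Z T : Spn K X} (k : W ⟶ Z) (x : Z ⟶ T) :
    Over (paste (comp₁Fst k (𝟙 S)).hom (comp₁Fst x (𝟙 S)).hom) (comp₁Fst (k ≫ x) (𝟙 S)).hom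
      (cell (postcomposeMapComp S k x).inv) (𝟙 (k.map ≫ x.map)) :=
  Over.inv (Θ := cellIso (postcomposeMapComp S k x)) (β := Iso.refl _)
    (postcomposeMapComp_overFst S k x)

/-- Every 2-cell between morphisms in the image of `S.postcompose K` descends to the apices. -/
theorem exists_overFst {S : Spn X Y} (hS : IsEquiv S.l) {W Z : Spn K X} {y x : W ⟶ Z}
    (α : comp₁ y (𝟙 S) ⟶ comp₁ x (𝟙 S)) :
    ∃ γ : y.map ⟶ x.map, Over (comp₁Fst y (𝟙 S)).hom (comp₁Fst x (𝟙 S)).hom (cell α) γ ∧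
      γ ▷ Z.l ≫ x.lam.hom = y.lam.hom := by
  have hW := hS.bipb_fst (n := W.r)
  let γ := hW.unwhiskerLeft
    ((comp₁Fst y (𝟙 S)).inv ≫ cell α ▷ (bipb Z.r S.l).fst ≫ (comp₁Fst x (𝟙 S)).hom)
  have hγ : Over (comp₁Fst y (𝟙 S)).hom (comp₁Fst x (𝟙 S)).hom (cell α) γ := by
    rw [Over, hW.whiskerLeft_unwhiskerLeft, Iso.hom_inv_id_assoc]
  -- Only the left legs descend: `α` respects legs into `Y`, which does not control the right legs
  -- of `y` and `x` into `X`.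
  exact ⟨γ, hγ, hW.whiskerLeft_injective ((hγ.leg_iff _ _).1 (cell_lam α))⟩

theorem eq_of_overFst {S : Spn X Y} (hS : IsEquiv S.l) {W Z : Spn K X} {y x : W ⟶ Z}
    {α β : comp₁ y (𝟙 S) ⟶ comp₁ x (𝟙 S)} {γ : y.map ⟶ x.map}
    (hα : Over (comp₁Fst y (𝟙 S)).hom (comp₁Fst x (𝟙 S)).hom (cell α) γ)
    (hβ : Over (comp₁Fst y (𝟙 S)).hom (comp₁Fst x (𝟙 S)).hom (cell β) γ) : α = β :=
  hom₂_ext (hS.ext_fst (hα.unique hβ rfl))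

theorem eq_of_comp₂_eq {S : Spn X Y} (hS : IsEquiv S.l) {W Z : Spn K X} {y x : W ⟶ Z}
    {σ τ : y ⟶ x} (h : comp₂ σ (𝟙 (𝟙 S)) = comp₂ τ (𝟙 (𝟙 S))) : σ = τ := by
  have h₁ := comp₂_overFst σ (𝟙 (𝟙 S))
  have h₂ := comp₂_overFst τ (𝟙 (𝟙 S))
  rw [h] at h₁
  refine hom₂_ext ((hS.bipb_fst (n := W.r)).whiskerLeft_injective ?_)
  rw [← cancel_epi (comp₁Fst y (𝟙 S)).hom]
  exact h₁.symm.trans h₂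

theorem eq_of_comp₂_over {S : Spn X Y} (hS : IsEquiv S.l) {W Z : Spn K X} {y x : W ⟶ Z}
    {α : comp₁ y (𝟙 S) ⟶ comp₁ x (𝟙 S)} {γ : y.map ⟶ x.map} {σ : y ⟶ x}
    (hα : Over (comp₁Fst y (𝟙 S)).hom (comp₁Fst x (𝟙 S)).hom (cell α) γ)
    (h : α = comp₂ σ (𝟙 (𝟙 S))) : γ = cell σ := by
  have h₂ := comp₂_overFst σ (𝟙 (𝟙 S))
  subst h
  refine (hS.bipb_fst (n := W.r)).whiskerLeft_injective ?_
  rw [← cancel_epi (comp₁Fst y (𝟙 S)).hom]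
  exact hα.symm.trans h₂

/-- The lift of `g` must be its descent `γ`. It respects right legs because `γ ≫ cell σ = cell τ`
and both `σ` and `τ` respect them. -/
theorem postcompose_isStronglyCartesian {S : Spn X Y} (hS : IsEquiv S.l) {Z T : Spn K X}
    {x' x : Z ⟶ T} (σ : x' ⟶ x) :
    ((S.postcompose K).toPrelaxFunctor.mapFunctor Z T).IsStronglyCartesian
      ((S.postcompose K).map₂ σ) σ := by
  let P := (S.postcompose K).toPrelaxFunctor.mapFunctor Z T
  refine { toIsHomLift := IsHomLift.map P σ, universal_property' := ?_ }
  intro y g τ hτ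
  change comp₁ y (𝟙 S) ⟶ comp₁ x' (𝟙 S) at g
  have h₁ : g ≫ comp₂ σ (𝟙 (𝟙 S)) = comp₂ τ (𝟙 (𝟙 S)) :=
    @IsHomLift.eq_of_isHomLift _ _ _ _ P _ _ _ τ hτ
  obtain ⟨γ, hγ, hl⟩ := exists_overFst hS g
  have h : γ ≫ cell σ = cell τ :=
    eq_of_comp₂_over (α := g ≫ comp₂ σ (𝟙 (𝟙 S))) hS (hγ.comp (comp₂_overFst σ (𝟙 (𝟙 S)))) h₁
  have hr : γ ▷ T.r ≫ x'.rho.hom = y.rho.hom := by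
    rw [← cell_rho σ, ← comp_whiskerRight_assoc, h, cell_rho]
  refine ⟨mkHom₂ _ _ γ hl hr, ⟨?_, hom₂_ext h⟩, ?_⟩
  · have : g = P.map (mkHom₂ _ _ γ hl hr) :=
      eq_of_overFst hS hγ (comp₂_overFst (mkHom₂ _ _ γ hl hr) (𝟙 (𝟙 S)))
    rw [this]
    exact IsHomLift.map P _
  · rintro χ ⟨h₁, -⟩
    exact hom₂_ext (eq_of_comp₂_over hS hγ (@IsHomLift.eq_of_isHomLift _ _ _ _ P _ _ g χ h₁)).symm

/-- The presentation of a morphism by its composites with the projections. -/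
def canonicalRep {X Y Z : A} {R : Spn X Z} {S : Spn X Y} {T : Spn Y Z} (f : R ⟶ comp S T) :
    Rep f (f.map ≫ (bipb S.r T.l).fst) (f.map ≫ (bipb S.r T.l).snd) ((bipb S.r T.l).cell f.map)
      (α_ _ _ _ ≪≫ f.lam) (α_ _ _ _ ≪≫ f.rho) where
  pres := ⟨Iso.refl _, Iso.refl _, by simp⟩
  lam_eq := by simp
  rho_eq := by simp

/-- The lift keeps the apex and left leg of `B`; its right leg into `X` is read off from the first
component of `f`, which then underlies `x`. -/
theorem exists_postcompose_lift {S : Spn X Y} (hS : IsEquiv S.l) (T : Spn K X) {B : Spn K Y}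
    (f : B ⟶ comp T S) : ∃ (Z : Spn K X) (x : Z ⟶ T) (e : B ⟶ comp Z S),
      IsEquiv e ∧ Nonempty (e ≫ comp₁ x (𝟙 S) ≅ f) := by
  let Z : Spn K X := ⟨B.apex, B.l, (f.map ≫ (bipb T.r S.l).fst) ≫ T.r⟩
  let x : Z ⟶ T := Hom.mk (f.map ≫ (bipb T.r S.l).fst) (α_ _ _ _ ≪≫ f.lam) (Iso.refl _)
  let φ : 𝟙 B.apex ≫ (f.map ≫ (bipb T.r S.l).fst) ≫ T.r ≅ (f.map ≫ (bipb T.r S.l).snd) ≫ S.l :=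
    λ_ _ ≪≫ (bipb T.r S.l).cell f.map
  obtain ⟨e, ⟨E⟩⟩ : ∃ e : B ⟶ comp Z S,
      Nonempty (Rep (S := Z) e (𝟙 B.apex) (f.map ≫ (bipb T.r S.l).snd) φ (λ_ _)
        (α_ _ _ _ ≪≫ f.rho)) := ⟨_, ⟨pairRep _ _ _ _ _⟩⟩
  -- The map of `e` is a section of the projection `fst`, an equivalence because `S.l` is; `fst` is
  -- therefore its inverse.
  refine ⟨Z, x, e, isEquiv_of_isEquiv_map ⟨(bipb Z.r S.l).fst, ⟨E.pres.e⟩,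
    ⟨hS.isoOfFst (α_ _ _ _ ≪≫ whiskerLeftIso _ E.pres.e ≪≫ ρ_ _ ≪≫ (λ_ _).symm)⟩⟩,
    ⟨Rep.iso (((comp₁Rep x (𝟙 S)).precomp e).trans
      ((α_ _ _ _).symm ≪≫ whiskerRightIso E.pres.e _ ≪≫ λ_ _)
      (whiskerLeftIso _ (ρ_ _) ≪≫ E.pres.f) ?_ ?_ ?_) (canonicalRep f)⟩⟩
  · refine (congrArg (· ≫ ((bipb T.r S.l).cell f.map).hom)
      (retraction_whiskerRight E.pres.e.hom _ _)).trans (Eq.trans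
        (by simp only [Category.assoc]; rfl) ((congrArg (fun z => (α_ _ _ _).hom ≫ e.map ◁ (α_ _ _ _).hom ≫ (α_ _ _ _).inv ≫ z)
          E.pres.w).trans ?_))
    simp [compSq_hom, x, Square.cell_hom]
    bicategory
  · refine (retraction_leg E.pres.e.hom ((α_ _ _ _).hom ≫ f.lam.hom)).trans ?_
    simp [E.lam_eq, x]
    rfl
  · simp [E.rho_eq]
    bicategory

/-- Descent along the projection from `comp W S` to `W` gives the 1-cell, its left triangle and `ψ`.
-/
theorem exists_postcompose_preimage {S : Spn X Y} (hS : IsEquiv S.l) {W Z T : Spn K X}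
    (x : Z ⟶ T) (t : comp W S ⟶ comp Z S) (m : W ⟶ T)
    (φ : t ≫ comp₁ x (𝟙 S) ≅ comp₁ m (𝟙 S)) :
    ∃ (k : W ⟶ Z) (κ : t.map ≫ (bipb Z.r S.l).fst ≅ (bipb W.r S.l).fst ≫ k.map) (ψ : k ≫ x ≅ m),
      t.lam.hom = (α_ _ _ _).inv ≫ κ.hom ▷ Z.l ≫ (α_ _ _ _).hom ≫
        (bipb W.r S.l).fst ◁ k.lam.hom ∧
      Over (paste κ.hom (comp₁Fst x (𝟙 S)).hom) (comp₁Fst m (𝟙 S)).hom (cell φ.hom)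
        (cell ψ.hom) := by
  have hW := hS.bipb_fst (n := W.r)
  obtain ⟨a, ⟨κ⟩⟩ : ∃ a : W.apex ⟶ Z.apex,
      Nonempty (t.map ≫ (bipb Z.r S.l).fst ≅ (bipb W.r S.l).fst ≫ a) :=
    ⟨hW.inverse ≫ t.map ≫ (bipb Z.r S.l).fst,
      ⟨(λ_ _).symm ≪≫ whiskerRightIso hW.unit.symm _ ≪≫ α_ _ _ _⟩⟩
  let lam : a ≫ Z.l ≅ W.l := hW.unwhiskerLeftIso
    ((α_ _ _ _).symm ≪≫ whiskerRightIso κ.symm Z.l ≪≫ α_ _ _ _ ≪≫ t.lam)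
  have hlam : t.lam.hom = (α_ _ _ _).inv ≫ κ.hom ▷ Z.l ≫ (α_ _ _ _).hom ≫
      (bipb W.r S.l).fst ◁ lam.hom := by simp [lam]
  let κ' : (t.map ≫ (comp₁ x (𝟙 S)).map) ≫ (bipb T.r S.l).fst ≅
      (bipb W.r S.l).fst ≫ a ≫ x.map := (α_ _ _ _ ≪≫ whiskerLeftIso _ (comp₁Fst x (𝟙 S))) ≪≫
    (α_ _ _ _).symm ≪≫ whiskerRightIso κ x.map ≪≫ α_ _ _ _
  let ψ : a ≫ x.map ≅ m.map := hW.unwhiskerLeftIso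
    (κ'.symm ≪≫ whiskerRightIso (cellIso φ) _ ≪≫ comp₁Fst m (𝟙 S))
  have hψ : Over κ'.hom (comp₁Fst m (𝟙 S)).hom (cell φ.hom) ψ.hom := by
    simp only [Over, ψ, IsEquiv.unwhiskerLeftIso_hom, IsEquiv.whiskerLeft_unwhiskerLeft,
      Iso.trans_hom, Iso.symm_hom, Iso.hom_inv_id_assoc]
    rfl
  -- The right triangle cannot come from `t`, which only knows legs into `Y`. It is defined from `ψ`
  -- and `m.rho`, so that `ψ` respects right legs by construction.
  let k : W ⟶ Z := Hom.mk a lam (whiskerLeftIso a x.rho.symm ≪≫ (α_ _ _ _).symm ≪≫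
    whiskerRightIso ψ T.r ≪≫ m.rho)
  let ψ' : k ≫ x ≅ m := mkIso (k ≫ x) m ψ (by
      refine hW.whiskerLeft_injective ((hψ.leg_iff _ _).1 ((cell_lam φ.hom).trans ?_))
      rw [comp_lam_hom, hlam]
      exact compLam_comp κ.hom _ lam.hom _) (by simp [k])
  exact ⟨k, κ, ψ', hlam, hψ⟩

theorem postcompose_isEquivalence {S : Spn X Y} (hS : IsEquiv S.l) {Z T : Spn K X} (x : Z ⟶ T)
    (W : Spn K X) : (cartesianComparison (S.postcompose K) x W).IsEquivalence := by
  let P := cartesianComparison (S.postcompose K) x W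
  have h₁ : P.Faithful := ⟨fun h => eq_of_comp₂_eq hS
    (congrArg Limits.CategoricalPullback.Hom.fst h)⟩
  have h₂ : P.Full := ⟨by
    intro y z ⟨(α : comp₁ y (𝟙 S) ⟶ comp₁ z (𝟙 S)), (β : y ≫ x ⟶ z ≫ x), h⟩
    replace h : α ▷ comp₁ x (𝟙 S) ≫ (postcomposeMapComp S z x).inv =
      (postcomposeMapComp S y x).inv ≫ comp₂ β (𝟙 (𝟙 S)) := h
    obtain ⟨γ, hγ, hl⟩ := exists_overFst hS α
    have hβ : γ ▷ x.map = cell β := by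
      have h₁ := (postcomposeMapComp_overFst S y x).comp
        ((hγ.whiskerRight (comp₁Fst x (𝟙 S)).hom).comp
          (postcomposeMapComp_inv_overFst S z x))
      have h₂ : 𝟙 (y.map ≫ x.map) ≫ γ ▷ x.map ≫ 𝟙 (z.map ≫ x.map) = γ ▷ x.map := by simp
      refine h₂.symm.trans (eq_of_comp₂_over (α := (postcomposeMapComp S y x).hom ≫
        α ▷ comp₁ x (𝟙 S) ≫ (postcomposeMapComp S z x).inv) hS h₁ ?_)
      rw [h, Iso.hom_inv_id_assoc]
    -- Right legs may be tested after composition with `x`, where `γ` becomes the 2-cell of spans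
    -- `β`.
    have hr : γ ▷ Z.r ≫ z.rho.hom = y.rho.hom := rho_of_comp_rho x γ (hβ ▸ cell_rho β)
    exact ⟨mkHom₂ _ _ γ hl hr, Limits.CategoricalPullback.hom_ext
      (eq_of_overFst hS (comp₂_overFst (mkHom₂ _ _ γ hl hr) (𝟙 (𝟙 S))) hγ) (hom₂_ext hβ)⟩⟩
  have h₃ : P.EssSurj := ⟨by
    intro ⟨(t : comp W S ⟶ comp Z S), (m : W ⟶ T), (φ : t ≫ comp₁ x (𝟙 S) ≅ comp₁ m (𝟙 S))⟩
    obtain ⟨k, κ, ψ, hlam, hψ⟩ := exists_postcompose_preimage hS x t m φ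
    -- Since `S.l` is an equivalence, the comparison with `t` is determined by its first component.
    let χ₀ : (comp₁ k (𝟙 S)).map ≅ t.map := hS.isoOfFst (comp₁Fst k (𝟙 S) ≪≫ κ.symm)
    have hχ : Over (comp₁Fst k (𝟙 S)).hom κ.hom χ₀.hom (𝟙 k.map) := by
      rw [Over, IsEquiv.isoOfFst_hom_fst, Bicategory.whiskerLeft_id]
      exact (Category.assoc _ _ _).trans (congrArg ((comp₁Fst k (𝟙 S)).hom ≫ ·) κ.inv_hom_id)
    have h : χ₀.hom ▷ (comp₁ x (𝟙 S)).map ≫ cell φ.hom =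
        cell ((postcomposeMapComp S k x).inv ≫ comp₂ ψ.hom (𝟙 (𝟙 S))) := by
      refine hS.ext_fst (((hχ.whiskerRight (comp₁Fst x (𝟙 S)).hom).comp hψ).unique
        ((postcomposeMapComp_inv_overFst S k x).comp (comp₂_overFst ψ.hom (𝟙 (𝟙 S)))) ?_)
      rw [id_whiskerRight]
    let χ : comp₁ k (𝟙 S) ≅ t := mkIso _ _ χ₀
      (by rw [hlam]; exact (hχ.leg_iff _ _).2 (by simp))
      -- After composition with `comp₁ x (𝟙 S)` and `φ`, the cell `χ₀` becomes a 2-cell of spans by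
      -- `h`, so it respects right legs.
      (rho_of_comp_rho (comp₁ x (𝟙 S)) _ (by
        rw [← cell_rho φ.hom, ← comp_whiskerRight_assoc, h]
        exact cell_rho _))
    exact ⟨k, ⟨Limits.CategoricalPullback.mkIso χ ψ (hom₂_ext h)⟩⟩⟩
  exact {}

theorem isGroupoidFibration_of_isEquiv {S : Spn X Y} (hS : IsEquiv S.l) :
    S.IsGroupoidFibration := fun _ =>
  { exists_lift := fun T _ f => exists_postcompose_lift hS T f
    cartesian := postcompose_isEquivalence hS
    cartesian₂ := postcompose_isStronglyCartesian hS }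

end Spn

end Fibration

/-! ### Component calculus for the triangle composites. -/

section Counit

section

variable {A : Type u} [Bicategory.{w, v} A] {K P S S' Z : A}

theorem leg_exchange {t : K ⟶ P} {d : P ⟶ S} {a : K ⟶ S} (e : t ≫ d ⟶ a) {h : S ⟶ S'}
    {l : S' ⟶ Z} {q : S ⟶ Z} (m : h ≫ l ⟶ q) :
    ((α_ t d h).inv ≫ e ▷ h) ▷ l ≫ (α_ a h l).hom ≫ a ◁ m =
      (α_ _ _ _).hom ≫ t ◁ ((α_ _ _ _).hom ≫ d ◁ m) ≫ (α_ _ _ _).inv ≫ e ▷ q := by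
  have h₁ : e ▷ (h ≫ l) ≫ a ◁ m = (t ≫ d) ◁ m ≫ e ▷ q := (whisker_exchange _ _).symm
  have h₂ : (α_ t d (h ≫ l)).hom ≫ t ◁ d ◁ m ≫ (α_ _ _ _).inv ≫ e ▷ q =
      e ▷ (h ≫ l) ≫ a ◁ m := by rw [h₁]; simp
  have h₃ := congrArg (fun z => (α_ _ _ _).inv ▷ l ≫ (α_ _ _ _).hom ≫ z) h₂
  simp only [whiskerRight_comp, Category.assoc] at h₃
  simpa using h₃.symm

theorem leg_exchange_inv {t : K ⟶ P} {d : P ⟶ S} {a : K ⟶ S} (e : t ≫ d ⟶ a) {h : S ⟶ S'}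
    {l : S' ⟶ Z} {q : S ⟶ Z} (m : q ⟶ h ≫ l) :
    e ▷ q ≫ a ◁ m ≫ (α_ a h l).inv = (α_ _ _ _).hom ≫ t ◁ (d ◁ m ≫ (α_ _ _ _).inv) ≫
      (α_ _ _ _).inv ≫ ((α_ t d h).inv ≫ e ▷ h) ▷ l := by
  rw [← whisker_exchange_assoc]
  simp

theorem whiskerRight_exchange {t a : K ⟶ P} (e : t ⟶ a) {d : P ⟶ S} {s : S ⟶ Z} {d' : P ⟶ S'}
    {s' : S' ⟶ Z} (m : d ≫ s ⟶ d' ≫ s') :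
    e ▷ d ▷ s ≫ (α_ _ _ _).hom ≫ a ◁ m ≫ (α_ _ _ _).inv =
      (α_ _ _ _).hom ≫ t ◁ m ≫ (α_ _ _ _).inv ≫ e ▷ d' ▷ s' := by
  have h := whisker_exchange e m
  rw [← associator_inv_naturality_left, reassoc_of% h]
  simp

theorem whiskerRight_conj {t a : K ⟶ P} (e : t ≅ a) {d : P ⟶ S} {s : S ⟶ Z} {d' : P ⟶ S'}
    {s' : S' ⟶ Z} (m : d ≫ s ⟶ d' ≫ s') :
    e.hom ▷ d ▷ s ≫ (α_ _ _ _).hom ≫ a ◁ m ≫ (α_ _ _ _).inv ≫ e.inv ▷ d' ▷ s' =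
      (α_ _ _ _).hom ≫ t ◁ m ≫ (α_ _ _ _).inv := by
  rw [reassoc_of% whiskerRight_exchange e.hom m, ← comp_whiskerRight, ← comp_whiskerRight,
    e.hom_inv_id]
  simp

end

variable {A : Type u} [Bicategory.{w, v} A] [FinitelyComplete A] {X Y Z : A}

namespace Spn

section

variable {R : Spn X Z} {S S' : Spn X Y} {T T' : Spn Y Z} {f : R ⟶ comp S T}
  {a : R.apex ⟶ S.apex} {b : R.apex ⟶ T.apex} {φ : a ≫ S.r ≅ b ≫ T.l} {lam : a ≫ S.l ≅ R.l}
  {rho : b ≫ T.r ≅ R.r}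

/-- The presentation of the composite with a horizontal composite. -/
def Rep.comp₁ (H : Rep f a b φ lam rho) (h : S ⟶ S') (k : T ⟶ T') :
    Rep (f ≫ Spn.comp₁ h k) (a ≫ h.map) (b ≫ k.map)
      (α_ _ _ _ ≪≫ whiskerLeftIso a h.rho ≪≫ φ ≪≫ whiskerLeftIso b k.lam.symm ≪≫ (α_ _ _ _).symm)
      (α_ _ _ _ ≪≫ whiskerLeftIso a h.lam ≪≫ lam) (α_ _ _ _ ≪≫ whiskerLeftIso b k.rho ≪≫ rho) :=
  ((comp₁Rep h k).precomp f).trans ((α_ _ _ _).symm ≪≫ whiskerRightIso H.pres.e h.map)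
    ((α_ _ _ _).symm ≪≫ whiskerRightIso H.pres.f k.map)
    (by
      have h₁ := leg_exchange H.pres.e.hom h.rho.hom
      have h₂ := leg_exchange_inv H.pres.f.hom k.lam.inv
      simp only [Iso.trans_hom, Iso.symm_hom, whiskerRightIso_hom, whiskerLeftIso_hom]
      rw [reassoc_of% h₁, reassoc_of% H.pres.w, h₂]
      simp [compSq_hom, Square.cell_hom])
    (by
      have h₁ := leg_exchange H.pres.e.hom h.lam.hom
      simp only [Iso.trans_hom, Iso.symm_hom, whiskerRightIso_hom, whiskerLeftIso_hom]
      rw [reassoc_of% h₁]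
      simp [H.lam_eq])
    (by
      have h₁ := leg_exchange H.pres.f.hom k.rho.hom
      simp only [Iso.trans_hom, Iso.symm_hom, whiskerRightIso_hom, whiskerLeftIso_hom]
      rw [reassoc_of% h₁]
      simp [H.rho_eq])

end

/-- The composite of a presented morphism with the right unitor. -/
def Rep.rightUnitorIso {R S : Spn X Y} {f : R ⟶ comp S (idSpan Y)} {a : R.apex ⟶ S.apex}
    {b : R.apex ⟶ Y} {φ : a ≫ S.r ≅ b ≫ 𝟙 Y} {lam : a ≫ S.l ≅ R.l} {rho : b ≫ 𝟙 Y ≅ R.r}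
    (H : Rep (T := idSpan Y) f a b φ lam rho) :
    f ≫ rightUnitorHom S ≅ Hom.mk a lam (φ ≪≫ rho) :=
  mkIso _ _ H.pres.e
    (by
      have := H.lam_eq
      simp [this, rightUnitorHom])
    (by
      have := H.pres.w
      simp [reassoc_of% this, rightUnitorHom, H.rho_eq, Square.cell_hom])

/-- The composite of a presented morphism with the left unitor. -/
def Rep.leftUnitorIso {R S : Spn X Y} {f : R ⟶ comp (idSpan X) S} {a : R.apex ⟶ X}
    {b : R.apex ⟶ S.apex} {φ : a ≫ 𝟙 X ≅ b ≫ S.l} {lam : a ≫ 𝟙 X ≅ R.l} {rho : b ≫ S.r ≅ R.r}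
    (H : Rep (S := idSpan X) f a b φ lam rho) :
    f ≫ leftUnitorHom S ≅ Hom.mk b (φ.symm ≪≫ lam) rho :=
  mkIso _ _ H.pres.f
    (by
      have := H.pres.w
      rw [← Iso.eq_comp_inv, Category.assoc] at this
      have h := congrArg (fun z => ((bipb (𝟙 X) S.l).cell f.map).inv ≫ z ≫ lam.hom) this
      simp [Square.cell] at h
      simp [leftUnitorHom, H.lam_eq, h])
    (by
      have := H.rho_eq
      simp [this, leftUnitorHom])

section

variable {W : A} {R : Spn X W} {S : Spn X Y} {T : Spn Y Z} {U : Spn Z W}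

/-- Reassociation regroups the components. The new second component `c` is left abstract: later
steps use only its presentation `Q`. -/
theorem Rep.exists_comp_assocHom {f : R ⟶ comp (comp S T) U} {a : R.apex ⟶ (comp S T).apex} {b : R.apex ⟶ U.apex}
    {φ : a ≫ (bipb S.r T.l).snd ≫ T.r ≅ b ≫ U.l} {lam : a ≫ (bipb S.r T.l).fst ≫ S.l ≅ R.l}
    {rho : b ≫ U.r ≅ R.r} (H : Rep (S := comp S T) f a b φ lam rho) :
    ∃ (c : R.apex ⟶ (comp T U).apex)
      (Q : Pres c (a ≫ (bipb S.r T.l).snd) b (α_ _ _ _ ≪≫ φ)),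
      Nonempty (Rep (T := comp T U) (f ≫ assocHom S T U) (a ≫ (bipb S.r T.l).fst) c
        (α_ _ _ _ ≪≫ whiskerLeftIso a (bipb S.r T.l).iso ≪≫ (α_ _ _ _).symm ≪≫
          whiskerRightIso Q.e.symm T.l ≪≫ α_ _ _ _) ((α_ _ _ _) ≪≫ lam)
        ((α_ _ _ _).symm ≪≫ whiskerRightIso Q.f U.r ≪≫ rho)) := by
  let Q : Pres (f.map ≫ lift _ _ (assocSq S T U)) (a ≫ (bipb S.r T.l).snd) b (α_ _ _ _ ≪≫ φ) :=
    ((liftPres _ _ (assocSq S T U)).whisker f.map).trans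
      ((α_ _ _ _).symm ≪≫ whiskerRightIso H.pres.e _) H.pres.f (by
        have := congrArg (fun z => (α_ _ _ _).inv ▷ T.r ≫ (α_ _ _ _).hom ≫ z) H.pres.w
        simp only [whiskerRight_comp, Category.assoc, Square.cell_hom,
          Iso.hom_inv_id_assoc] at this
        simp [assocSq, this])
  let P : Rep (S := S) (T := comp T U) (assocHom S T U) _ _ _ _ _ := pairRep _ _ _ _ _
  refine ⟨_, Q, ⟨(P.precomp f).trans ((α_ _ _ _).symm ≪≫ whiskerRightIso H.pres.e _)
    (Iso.refl _) ?_ ?_ ?_⟩⟩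
  · have := whiskerRight_conj H.pres.e (bipb S.r T.l).iso.hom
    simp [Q, reassoc_of% this]
  · simp [H.lam_eq]
  · simp [H.rho_eq, Q]

theorem Rep.exists_comp_assocInv {f : R ⟶ comp S (comp T U)} {a : R.apex ⟶ S.apex}
    {b : R.apex ⟶ (comp T U).apex} {φ : a ≫ S.r ≅ b ≫ (bipb T.r U.l).fst ≫ T.l}
    {lam : a ≫ S.l ≅ R.l} {rho : b ≫ (bipb T.r U.l).snd ≫ U.r ≅ R.r}
    (H : Rep (T := comp T U) f a b φ lam rho) :
    ∃ (c : R.apex ⟶ (comp S T).apex)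
      (Q : Pres c a (b ≫ (bipb T.r U.l).fst) (φ ≪≫ (α_ _ _ _).symm)),
      Nonempty (Rep (S := comp S T) (f ≫ assocInv S T U) c (b ≫ (bipb T.r U.l).snd)
        ((α_ _ _ _).symm ≪≫ whiskerRightIso Q.f T.r ≪≫ α_ _ _ _ ≪≫
          whiskerLeftIso b (bipb T.r U.l).iso ≪≫ (α_ _ _ _).symm)
        ((α_ _ _ _).symm ≪≫ whiskerRightIso Q.e S.l ≪≫ lam) (α_ _ _ _ ≪≫ rho)) := by
  let Q : Pres (f.map ≫ lift _ _ (assocInvSq S T U)) a (b ≫ (bipb T.r U.l).fst)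
      (φ ≪≫ (α_ _ _ _).symm) :=
    ((liftPres _ _ (assocInvSq S T U)).whisker f.map).trans H.pres.e
      ((α_ _ _ _).symm ≪≫ whiskerRightIso H.pres.f _) (by
        have := congrArg (fun z => z ≫ (α_ _ _ _).inv) H.pres.w
        simp only [whiskerRight_comp, Category.assoc, Square.cell_hom] at this
        simp [assocInvSq, this])
  let P : Rep (S := comp S T) (T := U) (assocInv S T U) _ _ _ _ _ := pairRep _ _ _ _ _
  refine ⟨_, Q, ⟨(P.precomp f).trans (Iso.refl _)
    ((α_ _ _ _).symm ≪≫ whiskerRightIso H.pres.f _) ?_ ?_ ?_⟩⟩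
  · have := whiskerRight_exchange H.pres.f.hom (bipb T.r U.l).iso.hom
    simp [Q, this]
  · simp [H.lam_eq, Q]
  · simp [H.rho_eq]

end


/-! ### The reversed span as right biadjoint. -/

section Reverse

variable {F : Spn X Y}

/-- The reverse of a span. -/
abbrev reverse (F : Spn X Y) : Spn Y X := ⟨F.apex, F.r, F.l⟩

/-- The two projections of the kernel of an equivalence are isomorphic. -/
def kernelIso (hF : IsEquiv F.l) : (bipb F.l F.l).fst ≅ (bipb F.l F.l).snd :=
  hF.unwhiskerRightIso (bipb F.l F.l).iso

/-- The counit of the biadjunction. -/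
def reverseCounit (hF : IsEquiv F.l) : comp (reverse F) F ⟶ idSpan Y :=
  -- The map goes through the first projection, so only the right triangle involves `kernelIso`.
  Hom.mk ((bipb F.l F.l).fst ≫ F.r) (ρ_ _) (ρ_ _ ≪≫ whiskerRightIso (kernelIso hF) F.r)

/-- The unit of the biadjunction. -/
def reverseUnit (hF : IsEquiv F.l) : idSpan X ⟶ comp F (reverse F) :=
  pair (T := reverse F) hF.inverse hF.inverse (Iso.refl _) hF.counit hF.counit

/-- The presentation of the unit. -/
def reverseUnitRep (hF : IsEquiv F.l) : Rep (T := reverse F) (reverseUnit hF) hF.inverse hF.inverse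
    (Iso.refl _) hF.counit hF.counit :=
  pairRep _ _ _ _ _

/-- Whiskered with `F.l`, `kernelIso` is the bipullback cell, which `Q` identifies with `φ`; so over
`c` it must be the descent `τ` of `φ`. -/
theorem kernelIso_whiskerLeft (hF : IsEquiv F.l) {K : A} {c : K ⟶ (bipb F.l F.l).pt}
    {x y : K ⟶ F.apex} {τ : x ≅ y} {φ : x ≫ F.l ≅ y ≫ F.l} (Q : Pres c x y φ)
    (h : τ.hom ▷ F.l = φ.hom) :
    c ◁ (kernelIso hF).hom = Q.e.hom ≫ τ.hom ≫ Q.f.inv := by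
  apply hF.whiskerRight_injective
  have := Q.w
  rw [← h] at this
  simp [reassoc_of% this, kernelIso, Square.cell_hom]

theorem Rep.comp_counit_rightUnitor (hF : IsEquiv F.l) {R : Spn X Y}
    {g : R ⟶ comp F (comp (reverse F) F)}
    {a : R.apex ⟶ F.apex} {b : R.apex ⟶ (bipb F.l F.l).pt}
    {φ : a ≫ F.r ≅ b ≫ (bipb F.l F.l).fst ≫ F.r} {lam : a ≫ F.l ≅ R.l}
    {rho : b ≫ (bipb F.l F.l).snd ≫ F.r ≅ R.r}
    (H : Rep (T := comp (reverse F) F) g a b φ lam rho) :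
    Nonempty (g ≫ Spn.comp₁ (𝟙 F) (reverseCounit hF) ≫ rightUnitorHom F ≅ Hom.mk a lam
      (φ ≪≫ whiskerLeftIso b (whiskerRightIso (kernelIso hF) F.r) ≪≫ rho)) := by
  refine ⟨(α_ _ _ _).symm ≪≫ (H.comp₁ (𝟙 F) (reverseCounit hF)).rightUnitorIso ≪≫
    mkIso _ _ (ρ_ a) ?_ ?_⟩
  · simp
  · simp [reverseCounit]

/-- Once `φ` is known to descend to `τ`, the kernel isomorphism in the counit becomes `τ` and the
auxiliary 1-cell into the kernel disappears. -/
theorem Rep.comp_assocHom_counit (hF : IsEquiv F.l) {R : Spn X Y}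
    {f : R ⟶ comp (comp F (reverse F)) F}
    {a : R.apex ⟶ (bipb F.r F.r).pt} {b : R.apex ⟶ F.apex}
    {φ : a ≫ (bipb F.r F.r).snd ≫ F.l ≅ b ≫ F.l} {lam : a ≫ (bipb F.r F.r).fst ≫ F.l ≅ R.l}
    {rho : b ≫ F.r ≅ R.r} (H : Rep (S := comp F (reverse F)) f a b φ lam rho)
    (τ : a ≫ (bipb F.r F.r).snd ≅ b) (hτ : τ.hom ▷ F.l = (α_ _ _ _).hom ≫ φ.hom) :
    Nonempty (f ≫ assocHom F (reverse F) F ≫ Spn.comp₁ (𝟙 F) (reverseCounit hF) ≫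
      rightUnitorHom F ≅ Hom.mk (a ≫ (bipb F.r F.r).fst) (α_ _ _ _ ≪≫ lam)
        (α_ _ _ _ ≪≫ whiskerLeftIso a (bipb F.r F.r).iso ≪≫ (α_ _ _ _).symm ≪≫
          whiskerRightIso τ F.r ≪≫ rho)) := by
  obtain ⟨c, Q, ⟨P⟩⟩ := H.exists_comp_assocHom
  obtain ⟨e⟩ := P.comp_counit_rightUnitor hF
  refine ⟨(α_ _ _ _).symm ≪≫ e ≪≫ mkIso _ _ (Iso.refl _) ?_ ?_⟩
  · simp
  · have := congrArg (fun z => (α_ c (bipb F.l F.l).fst F.r).inv ≫ z ▷ F.r)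
      (kernelIso_whiskerLeft hF Q hτ)
    simp at this
    simp [reassoc_of% this]

/-- The first triangle identity. -/
theorem unit_triangle (hF : IsEquiv F.l) :
    Nonempty (leftUnitorInv F ≫ comp₁ (reverseUnit hF) (𝟙 F) ≫ assocHom F (reverse F) F ≫
      comp₁ (𝟙 F) (reverseCounit hF) ≫ rightUnitorHom F ≅ 𝟙 F) := by
  let E := reverseUnitRep hF
  let H : Rep (S := idSpan X) (leftUnitorInv F) _ _ _ _ _ := pairRep _ _ _ _ _
  -- Up to coherence `τ` is `hF.unit`, and the condition on `τ ▷ F.l` is the first triangle identity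
  -- of the equivalence `F.l`.
  let τ : (F.l ≫ (reverseUnit hF).map) ≫ (bipb F.r F.r).snd ≅ 𝟙 F.apex ≫ 𝟙 F.apex :=
    α_ _ _ _ ≪≫ whiskerLeftIso F.l E.pres.f ≪≫ hF.unit ≪≫ (λ_ _).symm
  obtain ⟨e⟩ := (H.comp₁ (reverseUnit hF) (𝟙 F)).comp_assocHom_counit hF τ (by
    have := E.rho_eq
    simp [τ, this]
    bicategory)
  refine ⟨(α_ _ _ _).symm ≪≫ e ≪≫ mkIso _ _
    (α_ _ _ _ ≪≫ whiskerLeftIso F.l E.pres.e ≪≫ hF.unit) ?_ ?_⟩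
  · simp [E.lam_eq]
  -- The square of the biadjunction unit is an identity, so the bipullback cell over it only
  -- exchanges the two projections, cancelling `τ`.
  · have := congrArg (F.l ◁ ·) E.pres.w
    simp [Square.cell_hom] at this
    simp [τ, reassoc_of% this]

theorem Rep.comp_counit_leftUnitor (hF : IsEquiv F.l) {R : Spn Y X}
    {g : R ⟶ comp (comp (reverse F) F) (reverse F)}
    {a : R.apex ⟶ (bipb F.l F.l).pt} {b : R.apex ⟶ F.apex}
    {φ : a ≫ (bipb F.l F.l).snd ≫ F.r ≅ b ≫ F.r} {lam : a ≫ (bipb F.l F.l).fst ≫ F.r ≅ R.l}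
    {rho : b ≫ F.l ≅ R.r}
    (H : Rep (S := comp (reverse F) F) (T := reverse F) g a b φ lam rho) :
    Nonempty (g ≫ Spn.comp₁ (reverseCounit hF) (𝟙 (reverse F)) ≫ leftUnitorHom (reverse F) ≅
      Hom.mk b (φ.symm ≪≫ whiskerLeftIso a (whiskerRightIso (kernelIso hF).symm F.r) ≪≫ lam)
        rho) := by
  refine ⟨(α_ _ _ _).symm ≪≫ (H.comp₁ (reverseCounit hF) (𝟙 (reverse F))).leftUnitorIso ≪≫
    mkIso _ _ (ρ_ b) ?_ ?_⟩
  · simp [reverseCounit]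
  · simp

theorem Rep.comp_assocInv_counit (hF : IsEquiv F.l) {R : Spn Y X}
    {f : R ⟶ comp (reverse F) (comp F (reverse F))}
    {a : R.apex ⟶ F.apex} {b : R.apex ⟶ (bipb F.r F.r).pt}
    {φ : a ≫ F.l ≅ b ≫ (bipb F.r F.r).fst ≫ F.l} {lam : a ≫ F.r ≅ R.l}
    {rho : b ≫ (bipb F.r F.r).snd ≫ F.l ≅ R.r}
    (H : Rep (S := reverse F) (T := comp F (reverse F)) f a b φ lam rho)
    (τ : a ≅ b ≫ (bipb F.r F.r).fst) (hτ : τ.hom ▷ F.l = φ.hom ≫ (α_ _ _ _).inv) :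
    Nonempty (f ≫ assocInv (reverse F) F (reverse F) ≫
      Spn.comp₁ (reverseCounit hF) (𝟙 (reverse F)) ≫ leftUnitorHom (reverse F) ≅
        Hom.mk (b ≫ (bipb F.r F.r).snd) (α_ _ _ _ ≪≫ whiskerLeftIso b (bipb F.r F.r).iso.symm ≪≫
          (α_ _ _ _).symm ≪≫ whiskerRightIso τ.symm F.r ≪≫ lam) (α_ _ _ _ ≪≫ rho)) := by
  obtain ⟨c, Q, ⟨P⟩⟩ := H.exists_comp_assocInv
  obtain ⟨e⟩ := P.comp_counit_leftUnitor hF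
  refine ⟨(α_ _ _ _).symm ≪≫ e ≪≫ mkIso _ _ (Iso.refl _) ?_ ?_⟩
  · have h : c ◁ (kernelIso hF).inv = Q.f.hom ≫ τ.inv ≫ Q.e.inv := by
      rw [← cancel_epi (c ◁ (kernelIso hF).hom), ← Bicategory.whiskerLeft_comp,
        Iso.hom_inv_id, kernelIso_whiskerLeft hF Q hτ]
      simp
    have := congrArg (fun z => (α_ c (bipb F.l F.l).snd F.r).inv ≫ z ▷ F.r) h
    simp at this
    simp [reassoc_of% this]
  · simp

/-- The second triangle identity. -/
theorem counit_triangle (hF : IsEquiv F.l) :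
    Nonempty (rightUnitorInv (reverse F) ≫ comp₁ (𝟙 (reverse F)) (reverseUnit hF) ≫
      assocInv (reverse F) F (reverse F) ≫ comp₁ (reverseCounit hF) (𝟙 (reverse F)) ≫
      leftUnitorHom (reverse F) ≅ 𝟙 (reverse F)) := by
  let E := reverseUnitRep hF
  let H : Rep (S := reverse F) (T := idSpan X) (rightUnitorInv (reverse F)) _ _ _ _ _ :=
    pairRep _ _ _ _ _
  let τ : (F.l ≫ (reverseUnit hF).map) ≫ (bipb F.r F.r).fst ≅ 𝟙 F.apex ≫ 𝟙 F.apex :=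
    α_ _ _ _ ≪≫ whiskerLeftIso F.l E.pres.e ≪≫ hF.unit ≪≫ (λ_ _).symm
  -- The inverse associator presents the kernel square in the opposite direction, hence `τ.symm`.
  -- Cancelling `τ.hom ▷ F.l` again reduces the condition to the first triangle identity.
  obtain ⟨e⟩ := (H.comp₁ (𝟙 (reverse F)) (reverseUnit hF)).comp_assocInv_counit hF τ.symm (by
    have := congrArg (F.l ◁ ·) E.lam_eq
    rw [← cancel_mono (τ.hom ▷ F.l)]
    simp at this
    have h := congrArg (hF.unit.inv ▷ F.l ≫ ·) hF.unit_whiskerRight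
    simp only [inv_hom_whiskerRight] at h
    simp [τ, reassoc_of% this.symm, ← reassoc_of% h]
    bicategory)
  refine ⟨(α_ _ _ _).symm ≪≫ e ≪≫ mkIso _ _
    (α_ _ _ _ ≪≫ whiskerLeftIso F.l E.pres.f ≪≫ hF.unit) ?_ ?_⟩
  · have := congrArg (F.l ◁ ·) E.pres.w
    simp [Square.cell_hom] at this
    simp [τ, reassoc_of% this]
  · simp [E.rho_eq]

theorem isRightBiadjoint_reverse (hF : IsEquiv F.l) : IsRightBiadjoint F (reverse F) :=
  ⟨reverseUnit hF, reverseCounit hF, unit_triangle hF, counit_triangle hF⟩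

end Reverse

end Spn

end Counit

end BicatSpan

end

theorem mainTheorem6 {A : Type u} [Bicategory.{w, v} A] [BicatSpan.FinitelyComplete A] {X Y : A}
    (S : BicatSpan.Spn X Y) :
    List.TFAE
      [∃ G : BicatSpan.Spn Y X, BicatSpan.Spn.IsRightBiadjoint S G,
        BicatSpan.IsEquiv S.l,
        ∃ f : X ⟶ Y, Nonempty (S ≌ BicatSpan.Spn.lowerStar f),
        S.IsGroupoidFibration] := by
  tfae_have 1 → 2 := fun ⟨_, h⟩ => h.isEquiv
  tfae_have 2 → 1 := fun h => ⟨_, BicatSpan.Spn.isRightBiadjoint_reverse h⟩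
  tfae_have 2 → 3 := BicatSpan.Spn.exists_equivalence_lowerStar
  tfae_have 3 → 2 := fun ⟨_, ⟨e⟩⟩ => BicatSpan.Spn.isEquiv_of_equivalence_lowerStar e
  tfae_have 2 → 4 := BicatSpan.Spn.isGroupoidFibration_of_isEquiv
  tfae_have 4 → 2 := BicatSpan.Spn.IsGroupoidFibration.isEquiv
  tfae_finish
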